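/- Let $(A,\Delta)$ be an algebraic quantum group over $\mathbb C$, that is, a regular multiplier Hopf algebra with a non-zero left integral $\varphi$. Explicitly: $A$ is a (not necessarily unital) associative $\mathbb C$-algebra with non-degenerate product; $\Delta:A\to M(A\otimes A)$ is a coassociative homomorphism into the multiplier algebra such that the four maps sending $a\otimes a'$ to $\Delta(a)(1\otimes a')$, $(a\otimes 1)\Delta(a')$, $\Delta(a)(a'\otimes 1)$ and $(1\otimes a)\Delta(a')$ are bijections of $A\otimes A$ onto itself; and $\varphi:A\to\mathbb C$ is a non-zero linear functional with $(\iota\otimes\varphi)\Delta(a)=\varphi(a)1$ for all $a\in A$. Let $B=\widehat A=\{\varphi(\,\cdot\,c): c\in A\}$ be its dual, paired with $A$ by evaluation, $\langle a,b\rangle=b(a)$. The product and the coproduct $\Delta:B\to M(B\otimes B)$ of $B$ are given by $$\langle a,bb'\rangle=\langle\Delta(a),b\otimes b'\rangle,\qquad \langle a\otimes a',\Delta(b)\rangle=\langle aa',b\rangle .$$ Here and below, a pairing $\langle x,y\rangle$ of an algebra $X$ with a space $Y$ is extended to multipliers $n\in M(X)$ by $\langle n,x\triangleright y\rangle=\langle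 nx,y\rangle$ and $\langle n,y\triangleleft x\rangle=\langle xn,y\rangle$, where $\langle x',x\triangleright y\rangle=\langle x'x,y\rangle$ and $\langle x',y\triangleleft x\rangle=\langle xx',y\rangle$. Let $S$ denote the antipode of $A$, and also that of $B$. There is a unique element $V\in M(B\otimes A)$ (the duality) such that $\langle V,a\otimes b\rangle=\langle a,b\rangle$ for all $a\in A$ and $b\in B$. For all $a\in A$, $b\in B$ the multipliers $(b\otimes 1)V(1\otimes a)$ and $(1\otimes a)V(b\otimes 1)$ lie in $B\otimes A$, and there are unique elements $(S\otimes\iota)V$ and $(\iota\otimes S)V$ of $M(B\otimes A)$ such that, for all $a\in A$ and $b\in B$, $$((S\otimes\iota)V)(S(b)\otimes a)=(S\otimes\iota)\big((b\otimes1)V(1\otimes a)\big),\qquad (S(b)\otimes a)((S\otimes\iota)V)=(S\otimes\iota)\big((1\otimes a)V(b\otimes1)\big),$$ $$((\iota\otimes S)V)(b\otimes S(a))=(\iota\otimes S)\big((1\otimes a)V(b\otimes1)\big),\qquad (b\otimes S(a))((\iota\otimes S)V)=(\iota\otimes S)\big((b\otimes1)V(1\otimes a)\big).$$ The element $V$ is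 invertible in $M(B\otimes A)$, and $$V^{-1}=(S\otimes\iota)V=(\iota\otimes S)V .$$ -/

import Mathlib

open scoped TensorProduct

noncomputable section

namespace AQG

/-! ### Multiplier algebras of non-unital complex algebras -/

section Multiplier

variable (A : Type*) [NonUnitalRing A] [Module ℂ A] [IsScalarTower ℂ A A] [SMulCommClass ℂ A A]

/-- The multiplier algebra `M(A)`, as an algebra of pairs `(L, R)` of linear maps of `A` with
`a (L b) = (R a) b`. We think of `L` as `b ↦ m b` and of `R` as `a ↦ a m`, so the
product of `(L, R)` and `(L', R')` is `(L ∘ L', R' ∘ R)`. -/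
def multiplierSubalgebra : Subalgebra ℂ (Module.End ℂ A × (Module.End ℂ A)ᵐᵒᵖ) where
  carrier := {p | ∀ a b : A, a * p.1 b = p.2.unop a * b}
  mul_mem' := by
    intro p q hp hq a b
    simp only [Set.mem_ofPred_eq] at hp hq
    simp [hp, hq]
  add_mem' := by
    intro p q hp hq a b
    simp only [Set.mem_ofPred_eq] at hp hq
    simp [hp, hq, mul_add, add_mul]
  algebraMap_mem' := by
    intro r a b
    simp [Algebra.algebraMap_eq_smul_one, mul_smul_comm, smul_mul_assoc]

/-- The multiplier algebra `M(A)`. -/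
def Multiplier : Type _ := multiplierSubalgebra A

instance : Ring (Multiplier A) := inferInstanceAs (Ring (multiplierSubalgebra A))

instance : Algebra ℂ (Multiplier A) := inferInstanceAs (Algebra ℂ (multiplierSubalgebra A))

variable {A}

/-- The element `m b` of `A`, for `m ∈ M(A)` and `b ∈ A`, as a linear map in `b`. -/
def Multiplier.left (m : Multiplier A) : A →ₗ[ℂ] A := m.1.1

/-- The element `a m` of `A`, for `m ∈ M(A)` and `a ∈ A`, as a linear map in `a`. -/
def Multiplier.right (m : Multiplier A) : A →ₗ[ℂ] A := m.1.2.unop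

/-- The canonical embedding `A → M(A)`. -/
def Multiplier.of (a : A) : Multiplier A :=
  ⟨(LinearMap.mulLeft ℂ a, MulOpposite.op (LinearMap.mulRight ℂ a)),
    fun x y => by simp [mul_assoc]⟩

variable {B : Type*} [NonUnitalRing B] [Module ℂ B] [IsScalarTower ℂ B B] [SMulCommClass ℂ B B]

/-- The multiplier `m ⊗ n` of `A ⊗ B`, for `m ∈ M(A)` and `n ∈ M(B)`. -/
def Multiplier.tmul (m : Multiplier A) (n : Multiplier B) : Multiplier (A ⊗[ℂ] B) :=
  ⟨(TensorProduct.map m.left n.left, MulOpposite.op (TensorProduct.map m.right n.right)), by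
    have hm : ∀ a b : A, a * m.left b = m.right a * b := m.2
    have hn : ∀ a b : B, a * n.left b = n.right a * b := n.2
    intro x y
    induction x with
    | zero => simp
    | add x x' hx hx' => simp only [MulOpposite.unop_op] at hx hx' ⊢; simp [add_mul, hx, hx']
    | tmul a b =>
      induction y with
      | zero => simp
      | add y y' hy hy' => simp only [MulOpposite.unop_op] at hy hy' ⊢; simp [mul_add, hy, hy']
      | tmul c d => simp [hm, hn]⟩

end Multiplier

/-! ### Regular multiplier Hopf algebras and integrals -/

section Slices

variable {X Y : Type*} [AddCommGroup X] [Module ℂ X] [AddCommGroup Y] [Module ℂ Y]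

/-- The map `ι ⊗ f : X ⊗ Y → X` for a linear functional `f` on `Y`. -/
def sliceRight (f : Module.Dual ℂ Y) : X ⊗[ℂ] Y →ₗ[ℂ] X :=
  (TensorProduct.rid ℂ X).toLinearMap ∘ₗ f.lTensor X

/-- The map `f ⊗ ι : X ⊗ Y → Y` for a linear functional `f` on `X`. -/
def sliceLeft (f : Module.Dual ℂ X) : X ⊗[ℂ] Y →ₗ[ℂ] Y :=
  (TensorProduct.lid ℂ Y).toLinearMap ∘ₗ f.rTensor Y

@[simp] theorem sliceRight_tmul (f : Module.Dual ℂ Y) (x : X) (y : Y) :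
    sliceRight f (x ⊗ₜ[ℂ] y) = f y • x := by simp [sliceRight]

@[simp] theorem sliceLeft_tmul (f : Module.Dual ℂ X) (x : X) (y : Y) :
    sliceLeft f (x ⊗ₜ[ℂ] y) = f x • y := by simp [sliceLeft]

end Slices

/-- A regular multiplier Hopf algebra structure on the (possibly non-unital) algebra `A`:
the product is non-degenerate, `Δ : A → M(A ⊗ A)` is a homomorphism, and the four canonical maps
* `T₁ (a ⊗ b) = Δ(a)(1 ⊗ b)`,
* `T₂ (a ⊗ b) = (a ⊗ 1)Δ(b)`,
* `T₃ (a ⊗ b) = Δ(a)(b ⊗ 1)`,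
* `T₄ (a ⊗ b) = (1 ⊗ a)Δ(b)`

take values in `A ⊗ A` and are bijections of `A ⊗ A` onto itself. Bijectivity of `T₁` and `T₂`
is the definition of a multiplier Hopf algebra; bijectivity of `T₃` and `T₄` is the same requirement
for the flipped coproduct, that is, regularity. The maps `Tᵢ` are determined by `Δ`.
Coassociativity is
`(a ⊗ 1 ⊗ 1)(Δ ⊗ ι)(Δ(b)(1 ⊗ c)) = (ι ⊗ Δ)((a ⊗ 1)Δ(b))(1 ⊗ 1 ⊗ c)`. -/
structure RegularMultiplierHopfAlgebra (A : Type*) [NonUnitalRing A] [Module ℂ A]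
    [IsScalarTower ℂ A A] [SMulCommClass ℂ A A] where
  eq_zero_of_mul_left : ∀ a : A, (∀ b, a * b = 0) → a = 0
  eq_zero_of_mul_right : ∀ a : A, (∀ b, b * a = 0) → a = 0
  Δ : A →ₙₐ[ℂ] Multiplier (A ⊗[ℂ] A)
  T₁ : (A ⊗[ℂ] A) ≃ₗ[ℂ] (A ⊗[ℂ] A)
  T₂ : (A ⊗[ℂ] A) ≃ₗ[ℂ] (A ⊗[ℂ] A)
  T₃ : (A ⊗[ℂ] A) ≃ₗ[ℂ] (A ⊗[ℂ] A)
  T₄ : (A ⊗[ℂ] A) ≃ₗ[ℂ] (A ⊗[ℂ] A)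
  T₁_spec : ∀ a b, Multiplier.of (T₁ (a ⊗ₜ b)) = Δ a * Multiplier.tmul 1 (Multiplier.of b)
  T₂_spec : ∀ a b, Multiplier.of (T₂ (a ⊗ₜ b)) = Multiplier.tmul (Multiplier.of a) 1 * Δ b
  T₃_spec : ∀ a b, Multiplier.of (T₃ (a ⊗ₜ b)) = Δ a * Multiplier.tmul (Multiplier.of b) 1
  T₄_spec : ∀ a b, Multiplier.of (T₄ (a ⊗ₜ b)) = Multiplier.tmul 1 (Multiplier.of a) * Δ b
  coassoc : ∀ a b c : A,
    TensorProduct.assoc ℂ A A A (T₂.toLinearMap.rTensor A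
      ((TensorProduct.assoc ℂ A A A).symm (a ⊗ₜ T₁ (b ⊗ₜ c)))) =
    T₁.toLinearMap.lTensor A (TensorProduct.assoc ℂ A A A (T₂ (a ⊗ₜ b) ⊗ₜ c))

/-- An algebraic quantum group: a regular multiplier Hopf algebra with a left integral `φ`, that is,
a non-zero linear functional with `(ι ⊗ φ)Δ(a) = φ(a)1` in `M(A)` for all `a`. As an equation
between multipliers, this reads
`(ι ⊗ φ)(Δ(a)(b ⊗ 1)) = φ(a)b` and `(ι ⊗ φ)((b ⊗ 1)Δ(a)) = φ(a)b` for all `a, b`. -/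
structure AlgebraicQuantumGroup (A : Type*) [NonUnitalRing A] [Module ℂ A]
    [IsScalarTower ℂ A A] [SMulCommClass ℂ A A] extends RegularMultiplierHopfAlgebra A where
  φ : Module.Dual ℂ A
  φ_ne_zero : φ ≠ 0
  left_invariant : ∀ a b : A, sliceRight φ (T₃ (a ⊗ₜ b)) = φ a • b
  left_invariant' : ∀ a b : A, sliceRight φ (T₂ (b ⊗ₜ a)) = φ a • b

/-! ### Counit and antipode -/

section Antipode

variable {X : Type*} [NonUnitalRing X] [Module ℂ X] [IsScalarTower ℂ X X] [SMulCommClass ℂ X X]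

/-- `ε` is a counit for the coproduct `Δ`: for all `a, b`, the multipliers `Δ(a)(1 ⊗ b)` and
`(a ⊗ 1)Δ(b)` lie in `X ⊗ X`, and
`(ε ⊗ ι)(Δ(a)(1 ⊗ b)) = ab` and `(ι ⊗ ε)((a ⊗ 1)Δ(b)) = ab`. -/
def IsCounit (Δ : X →ₗ[ℂ] Multiplier (X ⊗[ℂ] X)) (ε : Module.Dual ℂ X) : Prop :=
  (∀ a b : X, ∃ t : X ⊗[ℂ] X,
    Multiplier.of t = Δ a * Multiplier.tmul 1 (Multiplier.of b) ∧ sliceLeft ε t = a * b) ∧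
  (∀ a b : X, ∃ t : X ⊗[ℂ] X,
    Multiplier.of t = Multiplier.tmul (Multiplier.of a) 1 * Δ b ∧ sliceRight ε t = a * b)

/-- `S` is an antipode for the coproduct `Δ`: with `ε` a counit and `m` the multiplication map,
`m(S ⊗ ι)(Δ(a)(1 ⊗ b)) = ε(a)b` and `m(ι ⊗ S)((a ⊗ 1)Δ(b)) = ε(b)a`. -/
def IsAntipode (Δ : X →ₗ[ℂ] Multiplier (X ⊗[ℂ] X)) (S : X →ₗ[ℂ] X) : Prop :=
  ∃ ε : Module.Dual ℂ X, IsCounit Δ ε ∧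
  (∀ a b : X, ∃ t : X ⊗[ℂ] X, Multiplier.of t = Δ a * Multiplier.tmul 1 (Multiplier.of b) ∧
    LinearMap.mul' ℂ X (S.rTensor X t) = ε a • b) ∧
  (∀ a b : X, ∃ t : X ⊗[ℂ] X, Multiplier.of t = Multiplier.tmul (Multiplier.of a) 1 * Δ b ∧
    LinearMap.mul' ℂ X (S.lTensor X t) = ε b • a)

end Antipode

/-! ### Extension of pairings to multipliers -/

section Pairings

variable {X Y X' Y' : Type*} [AddCommGroup X'] [Module ℂ X'] [AddCommGroup Y] [Module ℂ Y]
  [AddCommGroup Y'] [Module ℂ Y']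

/-- The tensor product of two pairings, `⟨x ⊗ x', y ⊗ y'⟩ = ⟨x, y⟩⟨x', y'⟩`. -/
def tensorPairing [AddCommGroup X] [Module ℂ X] (p : X →ₗ[ℂ] Module.Dual ℂ Y)
    (q : X' →ₗ[ℂ] Module.Dual ℂ Y') : (X ⊗[ℂ] X') →ₗ[ℂ] Module.Dual ℂ (Y ⊗[ℂ] Y') :=
  TensorProduct.dualDistrib ℂ Y Y' ∘ₗ TensorProduct.map p q

variable [NonUnitalRing X] [Module ℂ X] [IsScalarTower ℂ X X] [SMulCommClass ℂ X X]

/-- The pairing `p` of the algebra `X` with the space `Y` induces a left and a right action of `X`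
on `Y`. Here `z = x ▷ y`, that is, `⟨x', z⟩ = ⟨x'x, y⟩` for all `x'`. -/
def IsLeftAct (p : X →ₗ[ℂ] Module.Dual ℂ Y) (x : X) (y z : Y) : Prop :=
  ∀ x' : X, p x' z = p (x' * x) y

/-- Here `z = y ◁ x`, that is, `⟨x', z⟩ = ⟨xx', y⟩` for all `x'`. -/
def IsRightAct (p : X →ₗ[ℂ] Module.Dual ℂ Y) (x : X) (y z : Y) : Prop :=
  ∀ x' : X, p x' z = p (x * x') y

/-- The functional `f` on `Y` is the value `⟨n, · ⟩` at the multiplier `n ∈ M(X)` of the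
extension of the pairing of `X` with `Y` to a pairing of `M(X)` with `Y`. This extension is given by
`⟨n, x ▷ y⟩ = ⟨nx, y⟩` and `⟨n, y ◁ x⟩ = ⟨xn, y⟩`. -/
def IsExtendedPairing (p : X →ₗ[ℂ] Module.Dual ℂ Y) (n : Multiplier X) (f : Module.Dual ℂ Y) :
    Prop :=
  (∀ (x : X) (y z : Y), IsLeftAct p x y z → f z = p (n.left x) y) ∧
  (∀ (x : X) (y z : Y), IsRightAct p x y z → f z = p (n.right x) y)

end Pairings

/-! ### Auxiliary facts -/

section Aux

variable {X Y : Type*} [AddCommGroup X] [Module ℂ X] [AddCommGroup Y] [Module ℂ Y]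

theorem eq_zero_of_sliceRight (t : X ⊗[ℂ] Y)
    (h : ∀ f : Module.Dual ℂ Y, sliceRight f t = 0) : t = 0 := by
  classical
  let b := Module.Basis.ofVectorSpace ℂ Y
  apply (TensorProduct.equivFinsuppOfBasisRight (M := X) b).injective
  rw [map_zero]
  ext i
  rw [Finsupp.zero_apply, ← h (b.coord i)]
  clear h
  induction t with
  | zero => simp
  | add s t hs ht => simp [hs, ht]
  | tmul x y => simp

theorem eq_zero_of_sliceLeft (t : X ⊗[ℂ] Y)
    (h : ∀ f : Module.Dual ℂ X, sliceLeft f t = 0) : t = 0 := by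
  apply (TensorProduct.comm ℂ X Y).injective
  rw [map_zero]
  apply eq_zero_of_sliceRight
  intro f
  rw [← h f]
  clear h
  induction t with
  | zero => simp
  | add s t hs ht => simp [hs, ht]
  | tmul x y => simp

theorem eq_zero_of_rTensor {ι : Type*} (g : ι → X →ₗ[ℂ] X)
    (hg : ∀ x, (∀ i, g i x = 0) → x = 0) (t : X ⊗[ℂ] Y)
    (h : ∀ i, (g i).rTensor Y t = 0) : t = 0 := by
  apply eq_zero_of_sliceRight
  intro f
  apply hg
  intro i
  rw [← map_zero (sliceRight f), ← h i]
  clear h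
  induction t with
  | zero => simp
  | add s t hs ht => simp [hs, ht]
  | tmul x y => simp

theorem eq_zero_of_lTensor {ι : Type*} (g : ι → Y →ₗ[ℂ] Y)
    (hg : ∀ x, (∀ i, g i x = 0) → x = 0) (t : X ⊗[ℂ] Y)
    (h : ∀ i, (g i).lTensor X t = 0) : t = 0 := by
  apply eq_zero_of_sliceLeft
  intro f
  apply hg
  intro i
  rw [← map_zero (sliceLeft f), ← h i]
  clear h
  induction t with
  | zero => simp
  | add s t hs ht => simp [hs, ht]
  | tmul x y => simp

end Aux

namespace RegularMultiplierHopfAlgebra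

variable {A : Type*} [NonUnitalRing A] [Module ℂ A] [IsScalarTower ℂ A A] [SMulCommClass ℂ A A]
  (G : RegularMultiplierHopfAlgebra A)

theorem tensor_eq_zero_left (G : RegularMultiplierHopfAlgebra A) (t : A ⊗[ℂ] A)
    (h : ∀ a b : A, t * (a ⊗ₜ b) = 0) : t = 0 := by
  refine eq_zero_of_lTensor (fun b : A => LinearMap.mulRight ℂ b)
    (fun x hx => G.eq_zero_of_mul_left x hx) t fun b => ?_
  refine eq_zero_of_rTensor (fun a : A => LinearMap.mulRight ℂ a)
    (fun x hx => G.eq_zero_of_mul_left x hx) _ fun a => ?_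
  rw [← h a b]
  clear h
  induction t with
  | zero => simp
  | add s t hs ht => simp only [map_add, add_mul, hs, ht]
  | tmul x y => simp

theorem tensor_eq_zero_right (G : RegularMultiplierHopfAlgebra A) (t : A ⊗[ℂ] A)
    (h : ∀ a b : A, (a ⊗ₜ b) * t = 0) : t = 0 := by
  refine eq_zero_of_lTensor (fun b : A => LinearMap.mulLeft ℂ b)
    (fun x hx => G.eq_zero_of_mul_right x hx) t fun b => ?_
  refine eq_zero_of_rTensor (fun a : A => LinearMap.mulLeft ℂ a)
    (fun x hx => G.eq_zero_of_mul_right x hx) _ fun a => ?_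
  rw [← h a b]
  clear h
  induction t with
  | zero => simp
  | add s t hs ht => simp only [map_add, mul_add, hs, ht]
  | tmul x y => simp

theorem left_mul (G : RegularMultiplierHopfAlgebra A) (m : Multiplier (A ⊗[ℂ] A))
    (s t : A ⊗[ℂ] A) : m.left (s * t) = m.left s * t := by
  have hm : ∀ x y, x * m.left y = m.right x * y := m.2
  rw [← sub_eq_zero]
  apply G.tensor_eq_zero_right
  intro a b
  rw [mul_sub, hm, ← mul_assoc (a ⊗ₜ b), hm, mul_assoc, sub_self]

theorem T₁_mul (a b : A) (t : A ⊗[ℂ] A) :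
    G.T₁ (a ⊗ₜ b) * t = (G.Δ a).left ((LinearMap.mulLeft ℂ b).lTensor A t) :=
  congrArg (fun m : Multiplier (A ⊗[ℂ] A) => m.left t) (G.T₁_spec a b)

theorem T₃_mul (a b : A) (t : A ⊗[ℂ] A) :
    G.T₃ (a ⊗ₜ b) * t = (G.Δ a).left ((LinearMap.mulLeft ℂ b).rTensor A t) :=
  congrArg (fun m : Multiplier (A ⊗[ℂ] A) => m.left t) (G.T₃_spec a b)

theorem mul_T₂ (a b : A) (t : A ⊗[ℂ] A) :
    t * G.T₂ (a ⊗ₜ b) = (G.Δ b).right ((LinearMap.mulRight ℂ a).rTensor A t) :=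
  congrArg (fun m : Multiplier (A ⊗[ℂ] A) => m.right t) (G.T₂_spec a b)

theorem Δ_left_tmul (a c c' : A) :
    (G.Δ a).left (c ⊗ₜ c') = (LinearMap.mulRight ℂ c).rTensor A (G.T₁ (a ⊗ₜ c')) := by
  rw [← sub_eq_zero]
  apply G.tensor_eq_zero_left
  intro x y
  have h : (LinearMap.mulRight ℂ c).rTensor A (G.T₁ (a ⊗ₜ c')) * (x ⊗ₜ y) =
      G.T₁ (a ⊗ₜ c') * ((c * x) ⊗ₜ y) := by
    generalize G.T₁ (a ⊗ₜ c') = t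
    induction t with
    | zero => simp
    | add s t hs ht => simp only [map_add, add_mul, hs, ht]
    | tmul u v => simp [mul_assoc]
  rw [sub_mul, h, G.T₁_mul, ← G.left_mul]
  simp

theorem Δ_left_tmul' (a c c' : A) :
    (G.Δ a).left (c ⊗ₜ c') = (LinearMap.mulRight ℂ c').lTensor A (G.T₃ (a ⊗ₜ c)) := by
  rw [← sub_eq_zero]
  apply G.tensor_eq_zero_left
  intro x y
  have h : (LinearMap.mulRight ℂ c').lTensor A (G.T₃ (a ⊗ₜ c)) * (x ⊗ₜ y) =
      G.T₃ (a ⊗ₜ c) * (x ⊗ₜ (c' * y)) := by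
    generalize G.T₃ (a ⊗ₜ c) = t
    induction t with
    | zero => simp
    | add s t hs ht => simp only [map_add, add_mul, hs, ht]
    | tmul u v => simp [mul_assoc]
  rw [sub_mul, h, G.T₃_mul, ← G.left_mul]
  simp

theorem Δ_left_T₃ (a p q : A) : (G.Δ a).left (G.T₃ (p ⊗ₜ q)) = G.T₃ ((a * p) ⊗ₜ q) := by
  rw [← sub_eq_zero]
  apply G.tensor_eq_zero_left
  intro x y
  rw [sub_mul, ← G.left_mul, G.T₃_mul, G.T₃_mul, map_mul, sub_eq_zero]
  rfl

/-- `T₂(d ⊗ a)(c ⊗ 1) = (d ⊗ 1)T₃(a ⊗ c)`. -/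
theorem T₂_T₃ (d a c : A) : (LinearMap.mulRight ℂ c).rTensor A (G.T₂ (d ⊗ₜ a)) =
    (LinearMap.mulLeft ℂ d).rTensor A (G.T₃ (a ⊗ₜ c)) := by
  have hm : ∀ x y, x * (G.Δ a).left y = (G.Δ a).right x * y := (G.Δ a).2
  rw [← sub_eq_zero]
  apply G.tensor_eq_zero_left
  intro x y
  apply G.tensor_eq_zero_right
  intro u v
  have h1 : (u ⊗ₜ v) * ((LinearMap.mulRight ℂ c).rTensor A (G.T₂ (d ⊗ₜ a)) * (x ⊗ₜ y)) =
      (u ⊗ₜ v) * G.T₂ (d ⊗ₜ a) * ((c * x) ⊗ₜ y) := by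
    rw [mul_assoc]
    congr 1
    generalize G.T₂ (d ⊗ₜ a) = t
    induction t with
    | zero => simp
    | add s t hs ht => simp only [map_add, add_mul, hs, ht]
    | tmul u v => simp [mul_assoc]
  have h2 : (u ⊗ₜ v) * ((LinearMap.mulLeft ℂ d).rTensor A (G.T₃ (a ⊗ₜ c)) * (x ⊗ₜ y)) =
      ((u * d) ⊗ₜ v) * (G.T₃ (a ⊗ₜ c) * (x ⊗ₜ y)) := by
    rw [← mul_assoc, ← mul_assoc]
    congr 1
    generalize G.T₃ (a ⊗ₜ c) = t
    induction t with
    | zero => simp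
    | add s t hs ht => simp only [map_add, mul_add, hs, ht]
    | tmul u v => simp [mul_assoc]
  rw [sub_mul, mul_sub, h1, h2, G.T₃_mul, G.mul_T₂, hm]
  simp

/-- Coassociativity in the form
`(Δ ⊗ ι)(Δ(a)(1 ⊗ e))(c ⊗ 1 ⊗ 1) = (ι ⊗ Δ)(Δ(a)(c ⊗ 1))(1 ⊗ 1 ⊗ e)`. -/
theorem coassoc' (a c e : A) :
    TensorProduct.assoc ℂ A A A
      ((G.T₃.toLinearMap ∘ₗ (TensorProduct.mk ℂ A A).flip c).rTensor A (G.T₁ (a ⊗ₜ e))) =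
    (G.T₁.toLinearMap ∘ₗ (TensorProduct.mk ℂ A A).flip e).lTensor A (G.T₃ (a ⊗ₜ c)) := by
  rw [← sub_eq_zero]
  refine eq_zero_of_rTensor (fun d : A => LinearMap.mulLeft ℂ d)
    (fun x hx => G.eq_zero_of_mul_right x hx) _ fun d => ?_
  rw [map_sub, sub_eq_zero]
  have h := congrArg ((LinearMap.mulRight ℂ c).rTensor (A ⊗[ℂ] A)) (G.coassoc d a e)
  have hl : ∀ t : A ⊗[ℂ] A, (LinearMap.mulRight ℂ c).rTensor (A ⊗[ℂ] A)
      (TensorProduct.assoc ℂ A A A (G.T₂.toLinearMap.rTensor A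
        ((TensorProduct.assoc ℂ A A A).symm (d ⊗ₜ t)))) =
      (LinearMap.mulLeft ℂ d).rTensor (A ⊗[ℂ] A) (TensorProduct.assoc ℂ A A A
        ((G.T₃.toLinearMap ∘ₗ (TensorProduct.mk ℂ A A).flip c).rTensor A t)) := by
    have key : ∀ (g : A →ₗ[ℂ] A) (s : A ⊗[ℂ] A) (v : A), g.rTensor (A ⊗[ℂ] A)
        (TensorProduct.assoc ℂ A A A (s ⊗ₜ v)) =
        TensorProduct.assoc ℂ A A A (g.rTensor A s ⊗ₜ v) := by
      intro g s v
      induction s with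
      | zero => simp
      | add s t hs ht => simp only [TensorProduct.add_tmul, map_add, hs, ht]
      | tmul x y => simp
    intro t
    induction t with
    | zero => simp
    | add s t hs ht => simp only [TensorProduct.tmul_add, map_add, hs, ht]
    | tmul u v => simp [key, G.T₂_T₃]
  have hr : ∀ t : A ⊗[ℂ] A, (LinearMap.mulRight ℂ c).rTensor (A ⊗[ℂ] A)
      (G.T₁.toLinearMap.lTensor A (TensorProduct.assoc ℂ A A A (t ⊗ₜ e))) =
      (G.T₁.toLinearMap ∘ₗ (TensorProduct.mk ℂ A A).flip e).lTensor A
        ((LinearMap.mulRight ℂ c).rTensor A t) := by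
    intro t
    induction t with
    | zero => simp
    | add s t hs ht => simp only [TensorProduct.add_tmul, map_add, hs, ht]
    | tmul u v => simp
  have hr' : ∀ t : A ⊗[ℂ] A, (LinearMap.mulLeft ℂ d).rTensor (A ⊗[ℂ] A)
      ((G.T₁.toLinearMap ∘ₗ (TensorProduct.mk ℂ A A).flip e).lTensor A t) =
      (G.T₁.toLinearMap ∘ₗ (TensorProduct.mk ℂ A A).flip e).lTensor A
        ((LinearMap.mulLeft ℂ d).rTensor A t) := by
    intro t
    induction t with
    | zero => simp
    | add s t hs ht => simp only [map_add, hs, ht]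
    | tmul u v => simp
  rw [hl, hr, G.T₂_T₃] at h
  rw [h, hr']

end RegularMultiplierHopfAlgebra

/-! ### The dual algebra -/

namespace AlgebraicQuantumGroup

open TensorProduct (dualDistrib)

variable {A : Type*} [NonUnitalRing A] [Module ℂ A] [IsScalarTower ℂ A A] [SMulCommClass ℂ A A]
  (G : AlgebraicQuantumGroup A)

/-- The functional `φ( · c)`, as a linear map in `c`. -/
def fourier : A →ₗ[ℂ] Module.Dual ℂ A := LinearMap.compr₂ (LinearMap.mul ℂ A).flip G.φ

@[simp] theorem fourier_apply (c a : A) : G.fourier c a = G.φ (a * c) := rfl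

/-- The dual `B` of `A`: the space of linear functionals on `A` of the form `φ( · c)`. -/
def Dual : Type _ := LinearMap.range G.fourier

instance : AddCommGroup G.Dual := inferInstanceAs (AddCommGroup (LinearMap.range G.fourier))

instance : Module ℂ G.Dual := inferInstanceAs (Module ℂ (LinearMap.range G.fourier))

/-- The pairing `⟨a, b⟩ = b(a)`, as a pairing of `B` with `A`. -/
def ev : G.Dual →ₗ[ℂ] Module.Dual ℂ A := (LinearMap.range G.fourier).subtype

theorem ev_injective : Function.Injective G.ev := Subtype.val_injective

/-- The element `φ( · c)` of `B`. -/
def toDual : A →ₗ[ℂ] G.Dual := G.fourier.rangeRestrict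

@[simp] theorem ev_toDual (c a : A) : G.ev (G.toDual c) a = G.φ (a * c) := rfl

theorem toDual_surjective : Function.Surjective G.toDual := G.fourier.surjective_rangeRestrict

/-- An element `c` with `b = φ( · c)`. -/
def rep (b : G.Dual) : A := (G.toDual_surjective b).choose

@[simp] theorem toDual_rep (b : G.Dual) : G.toDual (G.rep b) = b :=
  (G.toDual_surjective b).choose_spec

/-- For `b = φ( · c)` and `b' = φ( · c')`, the functional
`a ↦ ⟨Δ(a), b ⊗ b'⟩ = (φ ⊗ φ)(Δ(a)(c ⊗ c'))`. -/
def convolution (c c' : A) : Module.Dual ℂ A where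
  toFun a := dualDistrib ℂ A A (G.φ ⊗ₜ G.φ) ((G.Δ a).left (c ⊗ₜ c'))
  map_add' a a' := by
    rw [map_add]
    exact map_add (dualDistrib ℂ A A (G.φ ⊗ₜ G.φ)) _ _
  map_smul' r a := by
    rw [map_smul]
    exact map_smul (dualDistrib ℂ A A (G.φ ⊗ₜ G.φ)) r _

theorem convolution_eq (c c' a : A) : G.convolution c c' a =
    dualDistrib ℂ A A (G.ev (G.toDual c) ⊗ₜ G.φ) (G.T₁ (a ⊗ₜ c')) := by
  change dualDistrib ℂ A A (G.φ ⊗ₜ G.φ) ((G.Δ a).left (c ⊗ₜ c')) = _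
  rw [G.Δ_left_tmul]
  generalize G.T₁ (a ⊗ₜ c') = t
  induction t with
  | zero => simp
  | add s t hs ht => simp only [map_add, hs, ht]
  | tmul x y => simp

theorem convolution_eq' (c c' a : A) : G.convolution c c' a =
    dualDistrib ℂ A A (G.φ ⊗ₜ G.ev (G.toDual c')) (G.T₃ (a ⊗ₜ c)) := by
  change dualDistrib ℂ A A (G.φ ⊗ₜ G.φ) ((G.Δ a).left (c ⊗ₜ c')) = _
  rw [G.Δ_left_tmul']
  generalize G.T₃ (a ⊗ₜ c) = t
  induction t with
  | zero => simp
  | add s t hs ht => simp only [map_add, hs, ht]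
  | tmul x y => simp

theorem convolution_mem (c c' : A) : G.convolution c c' ∈ LinearMap.range G.fourier := by
  have key : ∀ t : A ⊗[ℂ] A, ∃ x : A, ∀ a : A,
      dualDistrib ℂ A A (G.φ ⊗ₜ G.φ) ((G.Δ a).left (G.T₃ t)) = G.φ (a * x) := by
    intro t
    induction t with
    | zero => exact ⟨0, by simp⟩
    | add s t hs ht =>
      obtain ⟨x, hx⟩ := hs
      obtain ⟨y, hy⟩ := ht
      exact ⟨x + y, fun a => by simp only [map_add, mul_add, hx, hy]⟩
    | tmul p q =>
      refine ⟨G.φ q • p, fun a => ?_⟩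
      have h : ∀ t : A ⊗[ℂ] A, dualDistrib ℂ A A (G.φ ⊗ₜ G.φ) t = G.φ (sliceRight G.φ t) := by
        intro t
        induction t with
        | zero => simp
        | add s t hs ht => simp only [map_add, hs, ht]
        | tmul x y => simp [mul_comm]
      rw [G.Δ_left_T₃, h, G.left_invariant, map_smul, mul_smul_comm, map_smul]
      simp [mul_comm]
  obtain ⟨x, hx⟩ := key (G.T₃.symm (c ⊗ₜ c'))
  refine ⟨x, ?_⟩
  ext a
  rw [fourier_apply, ← hx a, LinearEquiv.apply_symm_apply]
  rfl

/-- The product of `B`, given by `⟨a, bb'⟩ = ⟨Δ(a), b ⊗ b'⟩`. -/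
instance : Mul G.Dual := ⟨fun b b' => ⟨G.convolution (G.rep b) (G.rep b'), G.convolution_mem _ _⟩⟩

/-- The product does not depend on the choice of representatives. -/
theorem ev_mul (b : G.Dual) (c' a : A) : G.ev (b * G.toDual c') a =
    dualDistrib ℂ A A (G.ev b ⊗ₜ G.φ) (G.T₁ (a ⊗ₜ c')) := by
  change G.convolution (G.rep b) (G.rep (G.toDual c')) a = _
  rw [convolution_eq', toDual_rep, ← convolution_eq', convolution_eq, toDual_rep]

theorem ev_mul' (c : A) (b' : G.Dual) (a : A) : G.ev (G.toDual c * b') a =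
    dualDistrib ℂ A A (G.φ ⊗ₜ G.ev b') (G.T₃ (a ⊗ₜ c)) := by
  change G.convolution (G.rep (G.toDual c)) (G.rep b') a = _
  rw [convolution_eq, toDual_rep, ← convolution_eq, convolution_eq', toDual_rep]

theorem ev_ext {b b' : G.Dual} (h : ∀ a, G.ev b a = G.ev b' a) : b = b' :=
  G.ev_injective (LinearMap.ext h)

protected theorem mul_add (x y z : G.Dual) : x * (y + z) = x * y + x * z := by
  obtain ⟨c, rfl⟩ := G.toDual_surjective x
  apply G.ev_ext
  intro a
  rw [ev_mul', map_add, map_add, LinearMap.add_apply, ev_mul', ev_mul', TensorProduct.tmul_add,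
    map_add, LinearMap.add_apply]

protected theorem add_mul (x y z : G.Dual) : (x + y) * z = x * z + y * z := by
  obtain ⟨c, rfl⟩ := G.toDual_surjective z
  apply G.ev_ext
  intro a
  rw [ev_mul, map_add, map_add, LinearMap.add_apply, ev_mul, ev_mul, TensorProduct.add_tmul,
    map_add, LinearMap.add_apply]

protected theorem mul_smul (r : ℂ) (x y : G.Dual) : x * (r • y) = r • (x * y) := by
  obtain ⟨c, rfl⟩ := G.toDual_surjective x
  apply G.ev_ext
  intro a
  rw [ev_mul', map_smul, map_smul, LinearMap.smul_apply, ev_mul', TensorProduct.tmul_smul,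
    map_smul, LinearMap.smul_apply]

protected theorem smul_mul (r : ℂ) (x y : G.Dual) : (r • x) * y = r • (x * y) := by
  obtain ⟨c, rfl⟩ := G.toDual_surjective y
  apply G.ev_ext
  intro a
  rw [ev_mul, map_smul, map_smul, LinearMap.smul_apply, ev_mul, ← TensorProduct.smul_tmul',
    map_smul, LinearMap.smul_apply]

protected theorem mul_assoc (x y z : G.Dual) : x * y * z = x * (y * z) := by
  obtain ⟨c, rfl⟩ := G.toDual_surjective x
  obtain ⟨e, rfl⟩ := G.toDual_surjective z
  apply G.ev_ext
  intro a
  rw [ev_mul, ev_mul']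
  have h := congrArg (dualDistrib ℂ A (A ⊗[ℂ] A)
    (G.φ ⊗ₜ dualDistrib ℂ A A (G.ev y ⊗ₜ G.φ))) (G.coassoc' a c e)
  have hl : ∀ t : A ⊗[ℂ] A, dualDistrib ℂ A (A ⊗[ℂ] A)
      (G.φ ⊗ₜ dualDistrib ℂ A A (G.ev y ⊗ₜ G.φ)) (TensorProduct.assoc ℂ A A A
        ((G.T₃.toLinearMap ∘ₗ (TensorProduct.mk ℂ A A).flip c).rTensor A t)) =
      dualDistrib ℂ A A (G.ev (G.toDual c * y) ⊗ₜ G.φ) t := by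
    have key : ∀ (s : A ⊗[ℂ] A) (v : A), dualDistrib ℂ A (A ⊗[ℂ] A)
        (G.φ ⊗ₜ dualDistrib ℂ A A (G.ev y ⊗ₜ G.φ)) (TensorProduct.assoc ℂ A A A (s ⊗ₜ v)) =
        dualDistrib ℂ A A (G.φ ⊗ₜ G.ev y) s * G.φ v := by
      intro s v
      induction s with
      | zero => simp
      | add s t hs ht => simp only [TensorProduct.add_tmul, map_add, hs, ht, add_mul]
      | tmul x y => simp [mul_assoc]
    intro t
    induction t with
    | zero => simp
    | add s t hs ht => simp only [map_add, hs, ht]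
    | tmul u v => simp [key, ev_mul']
  have hr : ∀ t : A ⊗[ℂ] A, dualDistrib ℂ A (A ⊗[ℂ] A)
      (G.φ ⊗ₜ dualDistrib ℂ A A (G.ev y ⊗ₜ G.φ))
        ((G.T₁.toLinearMap ∘ₗ (TensorProduct.mk ℂ A A).flip e).lTensor A t) =
      dualDistrib ℂ A A (G.φ ⊗ₜ G.ev (y * G.toDual e)) t := by
    intro t
    induction t with
    | zero => simp
    | add s t hs ht => simp only [map_add, hs, ht]
    | tmul u v => simp [ev_mul]
  rw [hl, hr] at h
  exact h

instance : NonUnitalRing G.Dual where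
  left_distrib := G.mul_add
  right_distrib := G.add_mul
  mul_assoc := G.mul_assoc
  zero_mul x := by simpa using G.smul_mul 0 0 x
  mul_zero x := by simpa using G.mul_smul 0 x 0

instance : IsScalarTower ℂ G.Dual G.Dual := ⟨fun r x y => G.smul_mul r x y⟩

instance : SMulCommClass ℂ G.Dual G.Dual := ⟨fun r x y => (G.mul_smul r x y).symm⟩

/-! ### The coproduct of the dual and the duality element -/

/-- `Δ'` is the coproduct of `B`: `⟨a ⊗ a', Δ'(b)⟩ = ⟨aa', b⟩`, where the pairing
of `B ⊗ B` with `A ⊗ A` is extended to `M(B ⊗ B)`. -/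
def IsDualCoproduct (Δ' : G.Dual →ₗ[ℂ] Multiplier (G.Dual ⊗[ℂ] G.Dual)) : Prop :=
  ∀ b : G.Dual, IsExtendedPairing (tensorPairing G.ev G.ev) (Δ' b) (G.ev b ∘ₗ LinearMap.mul' ℂ A)

/-- `V ∈ M(B ⊗ A)` is the duality: `⟨V, a ⊗ b⟩ = ⟨a, b⟩`, where the
pairing of `B ⊗ A` with `A ⊗ B` is extended to `M(B ⊗ A)`. -/
def IsDuality (V : Multiplier (G.Dual ⊗[ℂ] A)) : Prop :=
  IsExtendedPairing (tensorPairing G.ev G.ev.flip) V (TensorProduct.lift G.ev.flip)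

end AlgebraicQuantumGroup

/-! ### Application of an antipode to one leg of a multiplier -/

section Legs

variable {X Y : Type*} [NonUnitalRing X] [Module ℂ X] [IsScalarTower ℂ X X] [SMulCommClass ℂ X X]
  [NonUnitalRing Y] [Module ℂ Y] [IsScalarTower ℂ Y Y] [SMulCommClass ℂ Y Y]

open Multiplier

/-- `W = (S ⊗ ι)V` in `M(X ⊗ Y)`, for an anti-homomorphism `S` of `X`: for all `x, y`, the
multipliers `(x ⊗ 1)V(1 ⊗ y)` and `(1 ⊗ y)V(x ⊗ 1)` lie in `X ⊗ Y`, and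
`W(S(x) ⊗ y) = (S ⊗ ι)((x ⊗ 1)V(1 ⊗ y))` and
`(S(x) ⊗ y)W = (S ⊗ ι)((1 ⊗ y)V(x ⊗ 1))`. -/
def IsAntiLeft (S : X →ₗ[ℂ] X) (V W : Multiplier (X ⊗[ℂ] Y)) : Prop :=
  ∀ (x : X) (y : Y),
    (∃ t : X ⊗[ℂ] Y, of t = tmul (of x) 1 * V * tmul 1 (of y) ∧
      W.left (S x ⊗ₜ y) = S.rTensor Y t) ∧
    (∃ t : X ⊗[ℂ] Y, of t = tmul 1 (of y) * V * tmul (of x) 1 ∧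
      W.right (S x ⊗ₜ y) = S.rTensor Y t)

/-- `W = (ι ⊗ S)V` in `M(X ⊗ Y)`, for an anti-homomorphism `S` of `Y`: for all `x, y`, the
multipliers `(1 ⊗ y)V(x ⊗ 1)` and `(x ⊗ 1)V(1 ⊗ y)` lie in `X ⊗ Y`, and
`W(x ⊗ S(y)) = (ι ⊗ S)((1 ⊗ y)V(x ⊗ 1))` and
`(x ⊗ S(y))W = (ι ⊗ S)((x ⊗ 1)V(1 ⊗ y))`. -/
def IsAntiRight (S : Y →ₗ[ℂ] Y) (V W : Multiplier (X ⊗[ℂ] Y)) : Prop :=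
  ∀ (x : X) (y : Y),
    (∃ t : X ⊗[ℂ] Y, of t = tmul 1 (of y) * V * tmul (of x) 1 ∧
      W.left (x ⊗ₜ S y) = S.lTensor X t) ∧
    (∃ t : X ⊗[ℂ] Y, of t = tmul (of x) 1 * V * tmul 1 (of y) ∧
      W.right (x ⊗ₜ S y) = S.lTensor X t)

end Legs

/-- `x` is the unique object with the property `P`. -/
def IsThe {α : Type*} (P : α → Prop) (x : α) : Prop := P x ∧ ∀ y, P y → y = x

end AQG

end

noncomputable section

namespace AQG

/-! ### Slice maps -/

section SliceCalculus

variable {X Y X' Y' : Type*} [AddCommGroup X] [Module ℂ X] [AddCommGroup Y] [Module ℂ Y]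
  [AddCommGroup X'] [Module ℂ X'] [AddCommGroup Y'] [Module ℂ Y']

/-! Slicing the `B`-leg with x ∈ A turns the duality into the actions of `B` on `A`: V(b ⊗ a) has
slice (b ▷ x)a, and (b ⊗ a)V has slice a(x ◁ b) (`slice_Vleft`, `slice_Vright`). Write b = φ( · c)
in the first case and b = ψ(d · ), with ψ = φ ∘ S, in the second. Invariance of the integrals
(`lact_F_mul`, `mul_ract_Ψ`) then shows that left and right multiplication by V are T₃⁻¹ and T₄⁻¹ up
to flips. So V is invertible because canonical maps are bijective, and its inverse W is given by T₃
and T₄.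

The antipode enters through strong invariance, S((ι ⊗ φ)(Δ(a)(1 ⊗ b))) = (ι ⊗ φ)((1 ⊗ a)Δ(b)), and
its analogue for ψ. They show that W has slices S(b ▷ x)a and aS(x ◁ b). Since (b ⊗ 1)V(1 ⊗ a) has
slice (x ◁ b)a, anti-multiplicativity of S gives W = (ι ⊗ S)V. The identities S(x) ◁ b = S(S(b) ▷ x)
and b ▷ S(x) = S(x ◁ S(b)) (`ract_S`, `lact_S`) give W = (S ⊗ ι)V.

This rests on the basic theory of `A`: counit, antipode with its inverse, faithfulness of φ, and
equality of the spaces of functionals φ( · c), φ(d · ) and ψ(d · ). That theory is developed for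
`CanonicalMaps`, so that `op` (opposite product) and `opCop` (opposite product and coproduct) yield
the mirror statements. On the dual side, multipliers are produced from functionals by
`exists_multiplier_tensor`. The coproduct of `B` is again T₃⁻¹ in Fourier coordinates, its counit is
φ( · c) ↦ φ(c), and its antipode is b ↦ b ∘ S. -/

theorem sliceRight_lTensor (f : Module.Dual ℂ Y') (g : Y →ₗ[ℂ] Y') (t : X ⊗[ℂ] Y) :
    sliceRight f (g.lTensor X t) = sliceRight (f ∘ₗ g) t := by
  induction t with
  | zero => simp
  | add s t hs ht => simp only [map_add, hs, ht]
  | tmul x y => simp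

theorem sliceRight_rTensor (f : Module.Dual ℂ Y) (g : X →ₗ[ℂ] X') (t : X ⊗[ℂ] Y) :
    sliceRight f (g.rTensor Y t) = g (sliceRight f t) := by
  induction t with
  | zero => simp
  | add s t hs ht => simp only [map_add, hs, ht]
  | tmul x y => simp

theorem sliceLeft_rTensor (f : Module.Dual ℂ X') (g : X →ₗ[ℂ] X') (t : X ⊗[ℂ] Y) :
    sliceLeft f (g.rTensor Y t) = sliceLeft (f ∘ₗ g) t := by
  induction t with
  | zero => simp
  | add s t hs ht => simp only [map_add, hs, ht]
  | tmul x y => simp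

theorem sliceLeft_lTensor (f : Module.Dual ℂ X) (g : Y →ₗ[ℂ] Y') (t : X ⊗[ℂ] Y) :
    sliceLeft f (g.lTensor X t) = g (sliceLeft f t) := by
  induction t with
  | zero => simp
  | add s t hs ht => simp only [map_add, hs, ht]
  | tmul x y => simp

theorem sliceLeft_map (f : Module.Dual ℂ X') (g : X →ₗ[ℂ] X') (h : Y →ₗ[ℂ] Y') (t : X ⊗[ℂ] Y) :
    sliceLeft f (TensorProduct.map g h t) = h (sliceLeft (f ∘ₗ g) t) := by
  induction t with
  | zero => simp
  | add s t hs ht => simp only [map_add, hs, ht]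
  | tmul x y => simp

@[simp] theorem sliceRight_comm (f : Module.Dual ℂ X) (t : X ⊗[ℂ] Y) :
    sliceRight f (TensorProduct.comm ℂ X Y t) = sliceLeft f t := by
  induction t with
  | zero => simp
  | add s t hs ht => simp only [map_add, hs, ht]
  | tmul x y => simp

@[simp] theorem sliceLeft_comm (f : Module.Dual ℂ Y) (t : X ⊗[ℂ] Y) :
    sliceLeft f (TensorProduct.comm ℂ X Y t) = sliceRight f t := by
  induction t with
  | zero => simp
  | add s t hs ht => simp only [map_add, hs, ht]
  | tmul x y => simp

theorem apply_sliceRight (g : Module.Dual ℂ X) (f : Module.Dual ℂ Y) (t : X ⊗[ℂ] Y) :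
    g (sliceRight f t) = f (sliceLeft g t) := by
  induction t with
  | zero => simp
  | add s t hs ht => simp only [map_add, hs, ht]
  | tmul x y => simp [mul_comm]

theorem dualDistrib_apply (f : Module.Dual ℂ X) (g : Module.Dual ℂ Y) (t : X ⊗[ℂ] Y) :
    TensorProduct.dualDistrib ℂ X Y (f ⊗ₜ g) t = f (sliceRight g t) := by
  induction t with
  | zero => simp
  | add s t hs ht => simp only [map_add, hs, ht]
  | tmul x y => simp [mul_comm]

theorem ext_sliceRight {t t' : X ⊗[ℂ] Y}
    (h : ∀ f : Module.Dual ℂ Y, sliceRight f t = sliceRight f t') : t = t' :=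
  sub_eq_zero.1 (eq_zero_of_sliceRight _ fun f => by rw [map_sub, h, sub_self])

theorem ext_sliceLeft {t t' : X ⊗[ℂ] Y}
    (h : ∀ f : Module.Dual ℂ X, sliceLeft f t = sliceLeft f t') : t = t' :=
  sub_eq_zero.1 (eq_zero_of_sliceLeft _ fun f => by rw [map_sub, h, sub_self])

theorem ext_dual {x y : X} (h : ∀ f : Module.Dual ℂ X, f x = f y) : x = y := by
  rw [← sub_eq_zero, ← Module.forall_dual_apply_eq_zero_iff ℂ]
  intro f
  rw [map_sub, h, sub_self]

theorem exists_apply_eq_one {φ : Module.Dual ℂ X} (hφ₀ : φ ≠ 0) : ∃ w, φ w = 1 := by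
  obtain ⟨w, hw⟩ : ∃ w, φ w ≠ 0 := by
    by_contra! h
    exact hφ₀ (LinearMap.ext h)
  exact ⟨(φ w)⁻¹ • w, by simp [hw]⟩

theorem lTensor_comm (g : X →ₗ[ℂ] X') (t : X ⊗[ℂ] Y) :
    g.lTensor Y (TensorProduct.comm ℂ X Y t) = TensorProduct.comm ℂ X' Y (g.rTensor Y t) := by
  induction t with
  | zero => simp
  | add s t hs ht => simp only [map_add, hs, ht]
  | tmul x y => simp

theorem rTensor_comm (g : Y →ₗ[ℂ] Y') (t : X ⊗[ℂ] Y) :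
    g.rTensor X (TensorProduct.comm ℂ X Y t) = TensorProduct.comm ℂ X Y' (g.lTensor X t) := by
  induction t with
  | zero => simp
  | add s t hs ht => simp only [map_add, hs, ht]
  | tmul x y => simp

end SliceCalculus

/-! ### Canonical maps of a regular multiplier Hopf algebra

The product is a bilinear map, so that the opposite structures live on the same vector space. -/

/-- A non-degenerate product on `A`, with the canonical maps
`T₁ (a ⊗ b) = Δ(a)(1 ⊗ b)`, `T₂ (a ⊗ b) = (a ⊗ 1)Δ(b)`, `T₃ (a ⊗ b) = Δ(a)(b ⊗ 1)`,
`T₄ (a ⊗ b) = (1 ⊗ a)Δ(b)` of a coassociative coproduct, and the maps `x ↦ Δ(a)x` and `x ↦ xΔ(a)`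
of `A ⊗ A`. -/
structure CanonicalMaps (A : Type*) [AddCommGroup A] [Module ℂ A] where
  mul : A →ₗ[ℂ] A →ₗ[ℂ] A
  assoc : ∀ a b c, mul (mul a b) c = mul a (mul b c)
  eq_zero_left : ∀ a, (∀ b, mul a b = 0) → a = 0
  eq_zero_right : ∀ a, (∀ b, mul b a = 0) → a = 0
  T₁ : (A ⊗[ℂ] A) ≃ₗ[ℂ] (A ⊗[ℂ] A)
  T₂ : (A ⊗[ℂ] A) ≃ₗ[ℂ] (A ⊗[ℂ] A)
  T₃ : (A ⊗[ℂ] A) ≃ₗ[ℂ] (A ⊗[ℂ] A)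
  T₄ : (A ⊗[ℂ] A) ≃ₗ[ℂ] (A ⊗[ℂ] A)
  left : A → (A ⊗[ℂ] A) →ₗ[ℂ] (A ⊗[ℂ] A)
  right : A → (A ⊗[ℂ] A) →ₗ[ℂ] (A ⊗[ℂ] A)
  T₂_T₁ : ∀ d a c, (mul.flip c).lTensor A (T₂ (d ⊗ₜ a)) = (mul d).rTensor A (T₁ (a ⊗ₜ c))
  T₂_T₃ : ∀ d a c, (mul.flip c).rTensor A (T₂ (d ⊗ₜ a)) = (mul d).rTensor A (T₃ (a ⊗ₜ c))
  T₄_T₁ : ∀ d a c, (mul.flip c).lTensor A (T₄ (d ⊗ₜ a)) = (mul d).lTensor A (T₁ (a ⊗ₜ c))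
  T₄_T₃ : ∀ d a c, (mul.flip c).rTensor A (T₄ (d ⊗ₜ a)) = (mul d).lTensor A (T₃ (a ⊗ₜ c))
  left_tmul₁ : ∀ a u v, left a (u ⊗ₜ v) = (mul.flip u).rTensor A (T₁ (a ⊗ₜ v))
  left_tmul₃ : ∀ a u v, left a (u ⊗ₜ v) = (mul.flip v).lTensor A (T₃ (a ⊗ₜ u))
  right_tmul₂ : ∀ a u v, right a (u ⊗ₜ v) = (mul v).lTensor A (T₂ (u ⊗ₜ a))
  right_tmul₄ : ∀ a u v, right a (u ⊗ₜ v) = (mul u).rTensor A (T₄ (v ⊗ₜ a))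
  left_T₁ : ∀ a b c, left a (T₁ (b ⊗ₜ c)) = T₁ (mul a b ⊗ₜ c)
  left_T₃ : ∀ a b c, left a (T₃ (b ⊗ₜ c)) = T₃ (mul a b ⊗ₜ c)
  right_T₂ : ∀ a b c, right a (T₂ (c ⊗ₜ b)) = T₂ (c ⊗ₜ mul b a)
  right_T₄ : ∀ a b c, right a (T₄ (c ⊗ₜ b)) = T₄ (c ⊗ₜ mul b a)
  coassoc₁₂ : ∀ (f g : Module.Dual ℂ A) (a c d : A),
    sliceLeft g (T₂ (d ⊗ₜ sliceRight f (T₁ (a ⊗ₜ c)))) =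
      sliceRight f (T₁ (sliceLeft g (T₂ (d ⊗ₜ a)) ⊗ₜ c))
  coassoc₃₄ : ∀ (f g : Module.Dual ℂ A) (a c d : A),
    sliceLeft g (T₃ (sliceRight f (T₄ (c ⊗ₜ a)) ⊗ₜ d)) =
      sliceRight f (T₄ (c ⊗ₜ sliceLeft g (T₃ (a ⊗ₜ d))))

namespace CanonicalMaps

variable {A : Type*} [AddCommGroup A] [Module ℂ A] (K : CanonicalMaps A)

/-- The canonical maps of the opposite algebra. -/
def op : CanonicalMaps A where
  mul := K.mul.flip
  assoc a b c := (K.assoc c b a).symm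
  eq_zero_left := K.eq_zero_right
  eq_zero_right := K.eq_zero_left
  T₁ := TensorProduct.comm ℂ A A ≪≫ₗ K.T₄
  T₂ := TensorProduct.comm ℂ A A ≪≫ₗ K.T₃
  T₃ := TensorProduct.comm ℂ A A ≪≫ₗ K.T₂
  T₄ := TensorProduct.comm ℂ A A ≪≫ₗ K.T₁
  left := K.right
  right := K.left
  T₂_T₁ d a c := (K.T₄_T₃ c a d).symm
  T₂_T₃ d a c := (K.T₂_T₃ c a d).symm
  T₄_T₁ d a c := (K.T₄_T₁ c a d).symm
  T₄_T₃ d a c := (K.T₂_T₁ c a d).symm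
  left_tmul₁ := K.right_tmul₄
  left_tmul₃ := K.right_tmul₂
  right_tmul₂ := K.left_tmul₃
  right_tmul₄ := K.left_tmul₁
  left_T₁ a b c := K.right_T₄ a b c
  left_T₃ a b c := K.right_T₂ a b c
  right_T₂ a b c := K.left_T₃ a b c
  right_T₄ a b c := K.left_T₁ a b c
  coassoc₁₂ := K.coassoc₃₄
  coassoc₃₄ := K.coassoc₁₂

/-- The canonical maps of the opposite algebra with the opposite coproduct. -/
def opCop : CanonicalMaps A where
  mul := K.mul.flip
  assoc a b c := (K.assoc c b a).symm
  eq_zero_left := K.eq_zero_right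
  eq_zero_right := K.eq_zero_left
  T₁ := TensorProduct.comm ℂ A A ≪≫ₗ K.T₂ ≪≫ₗ TensorProduct.comm ℂ A A
  T₂ := TensorProduct.comm ℂ A A ≪≫ₗ K.T₁ ≪≫ₗ TensorProduct.comm ℂ A A
  T₃ := TensorProduct.comm ℂ A A ≪≫ₗ K.T₄ ≪≫ₗ TensorProduct.comm ℂ A A
  T₄ := TensorProduct.comm ℂ A A ≪≫ₗ K.T₃ ≪≫ₗ TensorProduct.comm ℂ A A
  left a := (TensorProduct.comm ℂ A A).toLinearMap ∘ₗ K.right a ∘ₗ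
    (TensorProduct.comm ℂ A A).toLinearMap
  right a := (TensorProduct.comm ℂ A A).toLinearMap ∘ₗ K.left a ∘ₗ
    (TensorProduct.comm ℂ A A).toLinearMap
  T₂_T₁ d a c := by simp [lTensor_comm, rTensor_comm, ← K.T₂_T₁]
  T₂_T₃ d a c := by simp [rTensor_comm, ← K.T₄_T₁]
  T₄_T₁ d a c := by simp [lTensor_comm, ← K.T₂_T₃]
  T₄_T₃ d a c := by simp [lTensor_comm, rTensor_comm, ← K.T₄_T₃]
  left_tmul₁ a u v := by simp [rTensor_comm, K.right_tmul₂]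
  left_tmul₃ a u v := by simp [lTensor_comm, K.right_tmul₄]
  right_tmul₂ a u v := by simp [lTensor_comm, K.left_tmul₁]
  right_tmul₄ a u v := by simp [rTensor_comm, K.left_tmul₃]
  left_T₁ a b c := by simp [K.right_T₂]
  left_T₃ a b c := by simp [K.right_T₄]
  right_T₂ a b c := by simp [K.left_T₁]
  right_T₄ a b c := by simp [K.left_T₃]
  coassoc₁₂ f g a c d := by simp [K.coassoc₁₂]
  coassoc₃₄ f g a c d := by simp [K.coassoc₃₄]

/-- The product as a map on the tensor product. -/
def m : A ⊗[ℂ] A →ₗ[ℂ] A := TensorProduct.lift K.mul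

@[simp] theorem m_tmul (a b : A) : K.m (a ⊗ₜ b) = K.mul a b := by simp [m]

@[simp] theorem op_mul (a b : A) : K.op.mul a b = K.mul b a := rfl

theorem op_m (t : A ⊗[ℂ] A) : K.op.m t = K.m (TensorProduct.comm ℂ A A t) := by
  induction t with
  | zero => simp
  | add s t hs ht => simp only [map_add, hs, ht]
  | tmul x y => simp

theorem opCop_m (t : A ⊗[ℂ] A) : K.opCop.m t = K.m (TensorProduct.comm ℂ A A t) := K.op_m t

theorem mul_left_cancel {a b : A} (h : ∀ c, K.mul c a = K.mul c b) : a = b :=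
  sub_eq_zero.1 (K.eq_zero_right _ fun c => by rw [map_sub, h, sub_self])

theorem mul_right_cancel {a b : A} (h : ∀ c, K.mul a c = K.mul b c) : a = b :=
  K.op.mul_left_cancel h

theorem lTensor_mul_right_cancel {t t' : A ⊗[ℂ] A}
    (h : ∀ c, (K.mul.flip c).lTensor A t = (K.mul.flip c).lTensor A t') : t = t' :=
  sub_eq_zero.1 (eq_zero_of_lTensor (fun c => K.mul.flip c) K.eq_zero_left _
    fun c => by rw [map_sub, h, sub_self])

theorem rTensor_mul_left_cancel {t t' : A ⊗[ℂ] A}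
    (h : ∀ c, (K.mul c).rTensor A t = (K.mul c).rTensor A t') : t = t' :=
  sub_eq_zero.1 (eq_zero_of_rTensor (fun c => K.mul c) K.eq_zero_right _
    fun c => by rw [map_sub, h, sub_self])

/-- `(g(d · ) ⊗ ι)Δ(a)`, as a linear map in `a`. -/
def L₂ (g : Module.Dual ℂ A) (d : A) : A →ₗ[ℂ] A :=
  sliceLeft g ∘ₗ K.T₂.toLinearMap ∘ₗ TensorProduct.mk ℂ A A d

@[simp] theorem L₂_apply (g : Module.Dual ℂ A) (d a : A) :
    K.L₂ g d a = sliceLeft g (K.T₂ (d ⊗ₜ a)) := rfl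

/-- `(ι ⊗ f( · c))Δ(a)`, as a linear map in `c`. -/
def R₁ (f : Module.Dual ℂ A) (a : A) : A →ₗ[ℂ] A :=
  sliceRight f ∘ₗ K.T₁.toLinearMap ∘ₗ TensorProduct.mk ℂ A A a

@[simp] theorem R₁_apply (f : Module.Dual ℂ A) (a c : A) :
    K.R₁ f a c = sliceRight f (K.T₁ (a ⊗ₜ c)) := rfl

/-- `(ι ⊗ f(c · ))Δ(a)`, as a linear map in `a`. -/
def R₄ (f : Module.Dual ℂ A) (c : A) : A →ₗ[ℂ] A :=
  sliceRight f ∘ₗ K.T₄.toLinearMap ∘ₗ TensorProduct.mk ℂ A A c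

@[simp] theorem R₄_apply (f : Module.Dual ℂ A) (c a : A) :
    K.R₄ f c a = sliceRight f (K.T₄ (c ⊗ₜ a)) := rfl

/-- The factor d meets only the left leg of Δ(y) and u only the right one, so T₂(d ⊗ y) may be
formed before multiplying by u. -/
theorem sliceLeft_mul_T₁ (g : Module.Dual ℂ A) (d : A) (t : A ⊗[ℂ] A) :
    sliceLeft (g ∘ₗ K.mul d) (K.T₁ t) = K.m ((K.L₂ g d).rTensor A t) := by
  induction t with
  | zero => simp
  | add s t hs ht => simp only [map_add, hs, ht]
  | tmul y u => rw [← sliceLeft_rTensor, ← K.T₂_T₁, sliceLeft_lTensor]; simp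

/-- Coassociativity without triple tensors: slicing at the left end commutes with Δ acting at the
right end. Consequently `L₂` also passes through T₁⁻¹. -/
theorem L₂_rTensor_T₁ (g : Module.Dual ℂ A) (d : A) (t : A ⊗[ℂ] A) :
    (K.L₂ g d).rTensor A (K.T₁ t) = K.T₁ ((K.L₂ g d).rTensor A t) := by
  induction t with
  | zero => simp
  | add s t hs ht => simp only [map_add, hs, ht]
  | tmul a c =>
    apply ext_sliceRight
    intro f
    rw [sliceRight_rTensor]
    simp [K.coassoc₁₂]

theorem ext_mul_sliceLeft {t t' : A ⊗[ℂ] A}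
    (h : ∀ (g : Module.Dual ℂ A) d, sliceLeft (g ∘ₗ K.mul d) t = sliceLeft (g ∘ₗ K.mul d) t') :
    t = t' := by
  apply K.rTensor_mul_left_cancel
  intro d
  apply ext_sliceLeft
  intro g
  rw [sliceLeft_rTensor, h, sliceLeft_rTensor]

/-! #### The counit -/

/-- `ε` is the counit. -/
structure Counit (ε : Module.Dual ℂ A) : Prop where
  T₁ : ∀ t, sliceLeft ε (K.T₁ t) = K.m t
  T₂ : ∀ t, sliceRight ε (K.T₂ t) = K.m t
  T₃ : ∀ t, sliceRight ε (K.T₃ t) = K.m t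
  T₄ : ∀ t, sliceLeft ε (K.T₄ t) = K.m t

/-- The map m ∘ T₁⁻¹ sends v ⊗ y to a scalar multiple of y, and that scalar is ε(v). On slices v =
(g ⊗ ι)((d ⊗ 1)Δ(x)) the scalar is g(dx), and surjectivity of T₂ makes every v a sum of such slices.
-/
theorem exists_counit (hA : ∃ (f : Module.Dual ℂ A) (u : A), f u = 1) : ∃ ε, K.Counit ε := by
  obtain ⟨g, u, hgu⟩ := hA
  have hE : ∀ (g : Module.Dual ℂ A) (d x y : A),
      K.m (K.T₁.symm (K.L₂ g d x ⊗ₜ y)) = g (K.mul d x) • y := by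
    intro g d x y
    have h : K.T₁.symm (K.L₂ g d x ⊗ₜ y) = (K.L₂ g d).rTensor A (K.T₁.symm (x ⊗ₜ y)) := by
      apply K.T₁.injective
      rw [← L₂_rTensor_T₁]
      simp
    rw [h, ← sliceLeft_mul_T₁]
    simp
  have hE' : ∀ (g : Module.Dual ℂ A) (t : A ⊗[ℂ] A) (y : A),
      K.m (K.T₁.symm (sliceLeft g (K.T₂ t) ⊗ₜ y)) = g (K.m t) • y := by
    intro g t y
    induction t with
    | zero => simp
    | add s t hs ht => simp only [map_add, hs, ht, TensorProduct.add_tmul, add_smul]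
    | tmul d x => simpa using hE g d x y
  -- Since g(u) = 1, v is the g-slice of T₂(T₂⁻¹(u ⊗ v)); `hE'` then dictates the value of ε at v.
  let ε : Module.Dual ℂ A := g ∘ₗ K.m ∘ₗ K.T₂.symm.toLinearMap ∘ₗ TensorProduct.mk ℂ A A u
  have hε : ∀ v y, K.m (K.T₁.symm (v ⊗ₜ y)) = ε v • y := by
    intro v y
    have := hE' g (K.T₂.symm (u ⊗ₜ v)) y
    rwa [LinearEquiv.apply_symm_apply, sliceLeft_tmul, hgu, one_smul] at this
  have h₁ : ∀ t, sliceLeft ε (K.T₁ t) = K.m t := by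
    intro t
    have : ∀ t, sliceLeft ε t = K.m (K.T₁.symm t) := by
      intro t
      induction t with
      | zero => simp
      | add s t hs ht => simp only [map_add, hs, ht]
      | tmul d x => rw [hε, sliceLeft_tmul]
    rw [this, LinearEquiv.symm_apply_apply]
  have h₂ : ∀ t, sliceRight ε (K.T₂ t) = K.m t := by
    intro t
    apply ext_dual
    intro f
    rw [apply_sliceRight]
    have h := hE' f t u
    rw [hε] at h
    simpa [hgu] using congrArg g h
  refine ⟨ε, h₁, h₂, fun t => ?_, fun t => ?_⟩
  · induction t with
    | zero => simp
    | add s t hs ht => simp only [map_add, hs, ht]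
    | tmul a c =>
      apply K.mul_left_cancel
      intro d
      rw [← sliceRight_rTensor, ← K.T₂_T₃, sliceRight_rTensor, h₂]
      simp [K.assoc]
  · induction t with
    | zero => simp
    | add s t hs ht => simp only [map_add, hs, ht]
    | tmul d a =>
      apply K.mul_right_cancel
      intro c
      change K.mul.flip c (sliceLeft ε (K.T₄ (d ⊗ₜ a))) = _
      rw [← sliceLeft_lTensor, K.T₄_T₁, sliceLeft_lTensor, h₁]
      simp [K.assoc]

variable {K} {ε : Module.Dual ℂ A}

theorem Counit.op (h : K.Counit ε) : K.op.Counit ε where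
  T₁ t := by rw [op_m, ← h.T₄]; rfl
  T₂ t := by rw [op_m, ← h.T₃]; rfl
  T₃ t := by rw [op_m, ← h.T₂]; rfl
  T₄ t := by rw [op_m, ← h.T₁]; rfl

theorem Counit.opCop (h : K.Counit ε) : K.opCop.Counit ε where
  T₁ t := by rw [opCop_m, ← h.T₂]; exact sliceLeft_comm _ _
  T₂ t := by rw [opCop_m, ← h.T₁]; exact sliceRight_comm _ _
  T₃ t := by rw [opCop_m, ← h.T₄]; exact sliceRight_comm _ _
  T₄ t := by rw [opCop_m, ← h.T₃]; exact sliceLeft_comm _ _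

/-- Multiplicativity of Δ: Δ(a)Δ(b)(1 ⊗ c) = Δ(ab)(1 ⊗ c), and ε ⊗ ι sends this to abc. -/
theorem sliceLeft_left_T₁ (hε : K.Counit ε) (a : A) (t : A ⊗[ℂ] A) :
    sliceLeft ε (K.left a (K.T₁ t)) = K.mul a (sliceLeft ε (K.T₁ t)) := by
  induction t with
  | zero => simp
  | add s t hs ht => simp only [map_add, hs, ht]
  | tmul b c => rw [K.left_T₁, hε.T₁, hε.T₁]; simp [K.assoc]

/-- Apply ε ⊗ ι to Δ(a)(p ⊗ q). By the preceding lemma the result is ε(p)aq, while the same element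
is T₁(a ⊗ q)(p ⊗ 1). As T₁ is onto, T₁(a ⊗ q) may be replaced by x ⊗ q. -/
theorem Counit.map_mul (hε : K.Counit ε) (x p : A) : ε (K.mul x p) = ε x * ε p := by
  -- A nonzero q is needed to cancel the vector in an equality of scalar multiples; the zero algebra
  -- is handled apart.
  by_cases hA : ∃ q : A, q ≠ 0
  swap
  · have : ∀ y : A, y = 0 := by simpa using hA
    simp [this x]
  have h : ∀ s : A ⊗[ℂ] A, sliceLeft ε ((K.mul.flip p).rTensor A (K.T₁ s)) =
      ε p • sliceLeft ε (K.T₁ s) := by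
    intro s
    induction s with
    | zero => simp
    | add s t hs ht => simp only [map_add, hs, ht, smul_add]
    | tmul a q =>
      rw [← K.left_tmul₁, hε.T₁, ← K.T₁.apply_symm_apply (p ⊗ₜ q), sliceLeft_left_T₁ hε,
        LinearEquiv.apply_symm_apply]
      simp
  obtain ⟨q, hq⟩ := hA
  have h' := h (K.T₁.symm (x ⊗ₜ q))
  rw [LinearEquiv.apply_symm_apply] at h'
  simp only [LinearMap.rTensor_tmul, LinearMap.flip_apply, sliceLeft_tmul, smul_smul] at h'
  rw [smul_left_injective ℂ hq h', mul_comm]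

/-! #### The antipode -/

variable (K) in
/-- `S` is the antipode, with respect to the counit `ε`. -/
structure Antipode (ε : Module.Dual ℂ A) (S : A →ₗ[ℂ] A) : Prop where
  counit : K.Counit ε
  T₁ : ∀ t, K.m (S.rTensor A (K.T₁ t)) = sliceLeft ε t
  T₂ : ∀ t, K.m (S.lTensor A (K.T₂ t)) = sliceRight ε t

variable (K) in
/-- `φ` is left invariant. -/
structure LeftInvariant (φ : Module.Dual ℂ A) : Prop where
  T₂ : ∀ a b, sliceRight φ (K.T₂ (b ⊗ₜ a)) = φ a • b
  T₃ : ∀ a b, sliceRight φ (K.T₃ (a ⊗ₜ b)) = φ a • b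

variable (K) in
/-- `ψ` is right invariant. -/
structure RightInvariant (ψ : Module.Dual ℂ A) : Prop where
  T₁ : ∀ a b, sliceLeft ψ (K.T₁ (a ⊗ₜ b)) = ψ a • b
  T₄ : ∀ a b, sliceLeft ψ (K.T₄ (b ⊗ₜ a)) = ψ a • b

variable {S S' : A →ₗ[ℂ] A} {φ ψ : Module.Dual ℂ A}

theorem LeftInvariant.op (h : K.LeftInvariant φ) : K.op.LeftInvariant φ := ⟨h.T₃, h.T₂⟩

theorem RightInvariant.op (h : K.RightInvariant ψ) : K.op.RightInvariant ψ := ⟨h.T₄, h.T₁⟩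

theorem RightInvariant.opCop (h : K.RightInvariant ψ) : K.opCop.LeftInvariant ψ where
  T₂ a b := (sliceRight_comm _ _).trans (h.T₁ a b)
  T₃ a b := (sliceRight_comm _ _).trans (h.T₄ a b)

theorem Antipode.opCop (h : K.Antipode ε S) : K.opCop.Antipode ε S where
  counit := h.counit.opCop
  T₁ t := by
    rw [opCop_m, ← lTensor_comm, ← sliceRight_comm, ← h.T₂]
    simp [CanonicalMaps.opCop]
  T₂ t := by
    rw [opCop_m, ← rTensor_comm, ← sliceLeft_comm, ← h.T₁]
    simp [CanonicalMaps.opCop]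

/-- In Sweedler notation T₁ sends a₁φ(a₂b₂) ⊗ b₁z to a₁ ⊗ a₂b₁z φ(a₃b₂), which left invariance
collapses to a₁φ(a₂b) ⊗ z. This is a closed form for T₁⁻¹ on slices. -/
theorem T₁_symm_slice (hφ : K.LeftInvariant φ) (a b z : A) :
    K.T₁ (TensorProduct.comm ℂ A A ((K.R₁ φ a).lTensor A (K.T₃ (b ⊗ₜ z)))) =
      sliceRight φ (K.T₁ (a ⊗ₜ b)) ⊗ₜ z := by
  apply K.ext_mul_sliceLeft
  intro g d
  rw [sliceLeft_mul_T₁]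
  have h : ∀ t : A ⊗[ℂ] A, K.m ((K.L₂ g d).rTensor A (TensorProduct.comm ℂ A A
      ((K.R₁ φ a).lTensor A t))) = sliceRight φ (K.left (K.L₂ g d a) t) := by
    intro t
    induction t with
    | zero => simp
    | add s t hs ht => simp only [map_add, hs, ht]
    | tmul u v =>
      rw [K.left_tmul₁, sliceRight_rTensor]
      simp [K.coassoc₁₂]
  rw [h, K.left_T₃, hφ.T₃, sliceLeft_tmul]
  congr 1
  rw [LinearMap.comp_apply, ← sliceRight_rTensor, ← K.T₂_T₁, sliceRight_lTensor, apply_sliceRight]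
  rfl

/-- Obtained by applying ε ⊗ ι to the closed form of T₁⁻¹. The right side is what S(x)z has to be,
so the left side exhibits S(x) as an element of A rather than only a left multiplier. -/
theorem slice_T₄_mul (hε : K.Counit ε) (hφ : K.LeftInvariant φ) (t : A ⊗[ℂ] A) (z : A) :
    K.mul (sliceRight φ (K.T₄ t)) z =
      sliceLeft ε (K.T₁.symm (sliceRight φ (K.T₁ t) ⊗ₜ z)) := by
  induction t with
  | zero => simp
  | add s t hs ht => simp only [map_add, LinearMap.add_apply, TensorProduct.add_tmul, hs, ht]
  | tmul a b =>
    rw [← T₁_symm_slice hφ, LinearEquiv.symm_apply_apply, sliceLeft_comm, sliceRight_lTensor]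
    have h : ε ∘ₗ K.R₁ φ a = φ ∘ₗ K.mul a := by
      ext v
      rw [LinearMap.comp_apply, R₁_apply, apply_sliceRight, hε.T₁]
      simp
    rw [h, ← sliceRight_lTensor, ← K.T₄_T₃, sliceRight_rTensor]
    rfl

theorem Antipode.mul_apply (hS : K.Antipode ε S) (x z : A) :
    K.mul (S x) z = sliceLeft ε (K.T₁.symm (x ⊗ₜ z)) := by
  rw [← hS.T₁, LinearEquiv.apply_symm_apply]
  simp

/-- `S((ι ⊗ φ)(Δ(a)(1 ⊗ b))) = (ι ⊗ φ)((1 ⊗ a)Δ(b))`. -/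
theorem Antipode.slice_T₁ (hS : K.Antipode ε S) (hφ : K.LeftInvariant φ) (t : A ⊗[ℂ] A) :
    S (sliceRight φ (K.T₁ t)) = sliceRight φ (K.T₄ t) := by
  apply K.mul_right_cancel
  intro z
  rw [slice_T₄_mul hS.counit hφ, hS.mul_apply]

/-- `S((ψ ⊗ ι)((a ⊗ 1)Δ(b))) = (ψ ⊗ ι)(Δ(a)(b ⊗ 1))`. -/
theorem Antipode.slice_T₂ (hS : K.Antipode ε S) (hψ : K.RightInvariant ψ) (t : A ⊗[ℂ] A) :
    S (sliceLeft ψ (K.T₂ t)) = sliceLeft ψ (K.T₃ t) := by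
  have h := hS.opCop.slice_T₁ hψ.opCop (TensorProduct.comm ℂ A A t)
  have h₁ : K.opCop.T₁ (TensorProduct.comm ℂ A A t) = TensorProduct.comm ℂ A A (K.T₂ t) := by
    simp [CanonicalMaps.opCop]
  have h₄ : K.opCop.T₄ (TensorProduct.comm ℂ A A t) = TensorProduct.comm ℂ A A (K.T₃ t) := by
    simp [CanonicalMaps.opCop]
  rwa [h₁, h₄, sliceRight_comm, sliceRight_comm] at h

theorem exists_antipode (hε : K.Counit ε) (hφ : K.LeftInvariant φ) (hφ₀ : φ ≠ 0) :
    ∃ S, K.Antipode ε S := by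
  obtain ⟨w, hw⟩ := exists_apply_eq_one hφ₀
  -- With φ(w) = 1, x is the φ-slice of T₁(T₁⁻¹(x ⊗ w)); strong invariance prescribes S(x) as the
  -- φ-slice of T₄ of the same tensor.
  let S : A →ₗ[ℂ] A := sliceRight φ ∘ₗ K.T₄.toLinearMap ∘ₗ K.T₁.symm.toLinearMap ∘ₗ
    (TensorProduct.mk ℂ A A).flip w
  have hS : ∀ x z, K.mul (S x) z = sliceLeft ε (K.T₁.symm (x ⊗ₜ z)) := by
    intro x z
    have := slice_T₄_mul hε hφ (K.T₁.symm (x ⊗ₜ w)) z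
    rwa [LinearEquiv.apply_symm_apply, sliceRight_tmul, hw, one_smul] at this
  have h₁ : ∀ t, K.m (S.rTensor A (K.T₁ t)) = sliceLeft ε t := by
    have : ∀ t, K.m (S.rTensor A t) = sliceLeft ε (K.T₁.symm t) := by
      intro t
      induction t with
      | zero => simp
      | add s t hs ht => simp only [map_add, hs, ht]
      | tmul x z => simp [hS]
    intro t
    rw [this, LinearEquiv.symm_apply_apply]
  refine ⟨S, hε, h₁, fun t => ?_⟩
  induction t with
  | zero => simp
  | add s t hs ht => simp only [map_add, hs, ht]
  | tmul p q =>
    apply K.mul_right_cancel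
    intro z
    -- The second antipode axiom is tested against a right factor z, so that S( · )z can be computed
    -- by T₁⁻¹. Slices of T₂ pass through T₁⁻¹, and the counit then turns T₂ into the product.
    have h : (K.mul.flip z ∘ₗ S).lTensor A (K.T₂ (p ⊗ₜ q)) =
        (K.mul p).rTensor A (K.T₁.symm (q ⊗ₜ z)) := by
      apply ext_sliceLeft
      intro f
      have hc : K.T₁.symm (K.L₂ f p q ⊗ₜ z) = (K.L₂ f p).rTensor A (K.T₁.symm (q ⊗ₜ z)) := by
        apply K.T₁.injective
        rw [← L₂_rTensor_T₁]
        simp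
      rw [sliceLeft_lTensor, sliceLeft_rTensor]
      change K.mul (S (K.L₂ f p q)) z = _
      rw [hS, hc, sliceLeft_rTensor]
      congr 2
      ext y
      change ε (sliceLeft f (K.T₂ (p ⊗ₜ y))) = f (K.mul p y)
      rw [← apply_sliceRight, hε.T₂, m_tmul]
    have hl : ∀ t, K.mul (K.m (S.lTensor A t)) z =
        K.m ((K.mul.flip z ∘ₗ S).lTensor A t) := by
      intro t
      induction t with
      | zero => simp
      | add s t hs ht => simp only [map_add, LinearMap.add_apply, hs, ht]
      | tmul x y => simp [K.assoc]
    have hr : ∀ t, K.m ((K.mul p).rTensor A t) = K.mul p (K.m t) := by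
      intro t
      induction t with
      | zero => simp
      | add s t hs ht => simp only [map_add, hs, ht]
      | tmul x y => simp [K.assoc]
    rw [hl, h, hr, ← hε.T₁, LinearEquiv.apply_symm_apply]
    simp

end CanonicalMaps

/-! ### Anti-multiplicativity and inverse of the antipode -/

namespace CanonicalMaps

variable {A : Type*} [AddCommGroup A] [Module ℂ A] {K : CanonicalMaps A}
  {ε φ ψ : Module.Dual ℂ A} {S S' : A →ₗ[ℂ] A}

variable (K) in
theorem op_op : K.op.op = K := by
  have h : ∀ T : (A ⊗[ℂ] A) ≃ₗ[ℂ] (A ⊗[ℂ] A),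
      TensorProduct.comm ℂ A A ≪≫ₗ (TensorProduct.comm ℂ A A ≪≫ₗ T) = T := by
    intro T
    ext t
    simp
  cases K
  simp only [op, mk.injEq]
  exact ⟨by simp, h _, h _, h _, h _, by simp, by simp⟩

theorem left_apply_T₁ (p : A) (t : A ⊗[ℂ] A) :
    K.left p (K.T₁ t) = K.T₁ ((K.mul p).rTensor A t) := by
  induction t with
  | zero => simp
  | add s t hs ht => simp only [map_add, hs, ht]
  | tmul b c => rw [K.left_T₁]; simp

/-- Multiplicativity of Δ gives T₁⁻¹(Δ(p)(y ⊗ q)) = (p ⊗ 1)T₁⁻¹(y ⊗ q). Applying ε ⊗ ι, with ε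
multiplicative, yields ε(p)S(y)q; replacing T₁(p ⊗ q) by x ⊗ z gives S(xy)z = S(y)S(x)z. -/
theorem Antipode.map_mul (hS : K.Antipode ε S) (x y : A) :
    S (K.mul x y) = K.mul (S y) (S x) := by
  have h : ∀ s, sliceLeft ε (K.T₁.symm ((K.mul.flip y).rTensor A (K.T₁ s))) =
      K.mul (S y) (sliceLeft ε s) := by
    intro s
    induction s with
    | zero => simp
    | add s t hs ht => simp only [map_add, hs, ht]
    | tmul p q =>
      have hp : K.T₁.symm ((K.mul.flip y).rTensor A (K.T₁ (p ⊗ₜ q))) =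
          (K.mul p).rTensor A (K.T₁.symm (y ⊗ₜ q)) := by
        apply K.T₁.injective
        rw [← left_apply_T₁, LinearEquiv.apply_symm_apply, LinearEquiv.apply_symm_apply,
          K.left_tmul₁]
      have hm : ε ∘ₗ K.mul p = ε p • ε := by
        ext z
        simp [hS.counit.map_mul]
      have hsm : ∀ t : A ⊗[ℂ] A, sliceLeft (ε p • ε) t = ε p • sliceLeft ε t := by
        intro t
        induction t with
        | zero => simp
        | add s t hs ht => simp only [map_add, hs, ht, smul_add]
        | tmul u v => simp [mul_smul]
      rw [hp, sliceLeft_rTensor, hm, hsm, ← hS.mul_apply]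
      simp
  apply K.mul_right_cancel
  intro z
  have h' := h (K.T₁.symm (x ⊗ₜ z))
  rw [LinearEquiv.apply_symm_apply, ← hS.mul_apply] at h'
  rw [hS.mul_apply, K.assoc, ← h']
  simp

theorem exists_sliceRight_T₁ (hφ₀ : φ ≠ 0) (x : A) : ∃ t, sliceRight φ (K.T₁ t) = x := by
  obtain ⟨w, hw⟩ := exists_apply_eq_one hφ₀
  exact ⟨K.T₁.symm (x ⊗ₜ w), by simp [hw]⟩

theorem exists_sliceLeft_T₂ (hφ₀ : φ ≠ 0) (x : A) : ∃ t, sliceLeft φ (K.T₂ t) = x := by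
  obtain ⟨w, hw⟩ := exists_apply_eq_one hφ₀
  exact ⟨K.T₂.symm (w ⊗ₜ x), by simp [hw]⟩

/-- The antipode of the opposite algebra is inverse to the antipode. -/
theorem Antipode.leftInverse_op (hS : K.Antipode ε S) (hS' : K.op.Antipode ε S')
    (hφ : K.LeftInvariant φ) (hφ₀ : φ ≠ 0) (x : A) : S' (S x) = x := by
  obtain ⟨t, rfl⟩ := exists_sliceRight_T₁ (K := K) hφ₀ x
  rw [hS.slice_T₁ hφ]
  -- Passing to `op` exchanges T₁ and T₄ up to the flip, so strong invariance there reverses the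
  -- formula for S.
  have h := hS'.slice_T₁ hφ.op (TensorProduct.comm ℂ A A t)
  simpa [op] using h

theorem Antipode.rightInverse_op (hS : K.Antipode ε S) (hS' : K.op.Antipode ε S')
    (hφ : K.LeftInvariant φ) (hφ₀ : φ ≠ 0) (x : A) : S (S' x) = x :=
  hS'.leftInverse_op (K.op_op.symm ▸ hS) hφ.op hφ₀ x

/-! #### Faithfulness of integrals -/

/-- Formally S(a₁c)a₂ = S(c)S(a₁)a₂; the auxiliary right factor z reduces this to the axiom for T₁.
-/
theorem Antipode.T₃ (hS : K.Antipode ε S) (a c : A) :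
    K.m (S.rTensor A (K.T₃ (a ⊗ₜ c))) = ε a • S c := by
  apply K.mul_right_cancel
  intro z
  have h₁ : ∀ t, K.mul (K.m (S.rTensor A t)) z =
      K.m (S.rTensor A ((K.mul.flip z).lTensor A t)) := by
    intro t
    induction t with
    | zero => simp
    | add s t hs ht => simp only [map_add, LinearMap.add_apply, hs, ht]
    | tmul x y => simp [K.assoc]
  have h₂ : ∀ t, K.m (S.rTensor A ((K.mul.flip c).rTensor A t)) =
      K.mul (S c) (K.m (S.rTensor A t)) := by
    intro t
    induction t with
    | zero => simp
    | add s t hs ht => simp only [map_add, hs, ht]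
    | tmul x y => simp [hS.map_mul, K.assoc]
  rw [h₁, ← K.left_tmul₃, K.left_tmul₁, h₂, hS.T₁]
  simp

/-- The space N = {a : φ( · a) = 0} contains the right legs of Δ(a) for a ∈ N: strong invariance
carries (ι ⊗ φ)(Δ(b)(1 ⊗ a)), which vanishes, to (ι ⊗ φ)((1 ⊗ b)Δ(a)). -/
theorem slice_T₃_eq_zero (hS : K.Antipode ε S) (hφ : K.LeftInvariant φ) {a : A}
    (ha : ∀ x, φ (K.mul x a) = 0) (b c : A) :
    sliceRight (φ ∘ₗ K.mul b) (K.T₃ (a ⊗ₜ c)) = 0 := by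
  have h₁ : sliceRight φ (K.T₁ (b ⊗ₜ a)) = 0 := by
    apply K.eq_zero_right
    intro d
    have h₀ : φ ∘ₗ K.mul.flip a = 0 := LinearMap.ext ha
    rw [← sliceRight_rTensor, ← K.T₂_T₁, sliceRight_lTensor, h₀]
    simp [sliceRight]
  rw [← sliceRight_lTensor, ← K.T₄_T₃, sliceRight_rTensor, ← hS.slice_T₁ hφ, h₁]
  simp

/-- The counit recovers ac from the right legs of Δ(a)(c ⊗ 1), which stay in N, so it suffices that
ε vanishes on N. If ε(a) ≠ 0 for some a ∈ N, then S(a₁c)a₂ = ε(a)S(c) puts the range of S, hence all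
of A, into N. Then φ kills all products, and these span A. -/
theorem faithful_right (hS : K.Antipode ε S) (hsurj : Function.Surjective S)
    (hφ : K.LeftInvariant φ) (hφ₀ : φ ≠ 0) {a : A} (ha : ∀ x, φ (K.mul x a) = 0) : a = 0 := by
  have hker : ∀ a, (∀ x, φ (K.mul x a) = 0) → ε a = 0 := by
    intro a ha
    by_contra hε
    -- The map v ↦ φ( · v) has kernel N; applying it to the right leg expresses membership in N as
    -- one tensor equation.
    have h₁ : ∀ c, (K.mul.flip.compr₂ φ).lTensor A (K.T₃ (a ⊗ₜ c)) = 0 := by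
      intro c
      apply eq_zero_of_sliceLeft
      intro f
      rw [sliceLeft_lTensor]
      ext b
      have := congrArg f (slice_T₃_eq_zero hS hφ ha b c)
      rwa [apply_sliceRight, map_zero] at this
    have h₂ : ∀ b c, φ (K.mul b (S c)) = 0 := by
      intro b c
      have h : ∀ t, φ (K.mul b (K.m (S.rTensor A t))) =
          TensorProduct.lift (LinearMap.applyₗ ∘ₗ K.mul b ∘ₗ S)
            ((K.mul.flip.compr₂ φ).lTensor A t) := by
        intro t
        induction t with
        | zero => simp
        | add s t hs ht => simp only [map_add, hs, ht]
        | tmul u v => simp [K.assoc]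
      have h' := h (K.T₃ (a ⊗ₜ c))
      rw [h₁, hS.T₃, map_zero] at h'
      simpa [hε] using h'
    apply hφ₀
    ext y
    have h₃ : ∀ t, φ (K.m t) = 0 := by
      intro t
      induction t with
      | zero => simp
      | add s t hs ht => simp only [map_add, hs, ht, add_zero]
      | tmul u v =>
        obtain ⟨v, rfl⟩ := hsurj v
        simp [h₂]
    -- Since ε(a) ≠ 0, each y is a multiple of m(T₁⁻¹(a ⊗ y)), hence a sum of products.
    have h₄ := h₃ (K.T₁.symm (a ⊗ₜ y))
    rw [← hS.counit.T₁, LinearEquiv.apply_symm_apply] at h₄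
    simpa [hε] using h₄
  apply K.eq_zero_left
  intro c
  apply ext_dual
  intro f
  rw [← m_tmul, ← hS.counit.T₃, apply_sliceRight, map_zero]
  apply hker
  intro b
  have := congrArg f (slice_T₃_eq_zero hS hφ ha b c)
  rwa [apply_sliceRight, map_zero] at this

/-! #### The antipode and the coproduct -/

theorem T₃_slice (φ : Module.Dual ℂ A) (p q c : A) :
    K.T₃ (sliceRight φ (K.T₄ (p ⊗ₜ q)) ⊗ₜ c) = (K.R₄ φ p).lTensor A (K.T₃ (q ⊗ₜ c)) := by
  apply ext_sliceLeft
  intro g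
  rw [K.coassoc₃₄, sliceLeft_lTensor]
  rfl

/-- For x a φ-slice of Δ(p)(1 ⊗ q), strong invariance writes S(x) as a slice of (1 ⊗ p)Δ(q), whose
coproduct is known from coassociativity. The factor S(d) allows strong invariance to be used again
to return to slices of T₁. -/
theorem Antipode.T₃_apply_mul (hS : K.Antipode ε S) (hφ : K.LeftInvariant φ) (hφ₀ : φ ≠ 0)
    (x c d : A) : (K.mul.flip (S d)).lTensor A (K.T₃ (S x ⊗ₜ c)) =
      (K.mul.flip c).rTensor A
        (TensorProduct.comm ℂ A A (TensorProduct.map S S (K.T₂ (d ⊗ₜ x)))) := by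
  obtain ⟨t, rfl⟩ := exists_sliceRight_T₁ (K := K) hφ₀ x
  induction t with
  | zero => simp
  | add s t hs ht =>
    simp only [map_add, TensorProduct.add_tmul, TensorProduct.tmul_add, hs, ht]
  | tmul p q =>
    apply ext_sliceRight
    intro f
    have h : f ∘ₗ K.mul.flip (S d) ∘ₗ K.R₄ φ p =
        φ ∘ₗ K.mul (sliceLeft (f ∘ₗ S) (K.T₂ (d ⊗ₜ p))) := by
      ext v
      change f (K.mul (sliceRight φ (K.T₄ (p ⊗ₜ v))) (S d)) = φ (K.mul.flip v _)
      rw [← hS.slice_T₁ hφ, ← hS.map_mul, ← sliceRight_rTensor, ← K.T₂_T₁, sliceRight_lTensor]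
      change (f ∘ₗ S) _ = _
      rw [apply_sliceRight]
      rfl
    rw [hS.slice_T₁ hφ, T₃_slice, sliceRight_lTensor, sliceRight_lTensor, LinearMap.comp_assoc, h,
      ← sliceRight_lTensor, ← K.T₄_T₃, sliceRight_rTensor, sliceRight_rTensor, sliceRight_comm,
      sliceLeft_map, K.coassoc₁₂, hS.slice_T₁ hφ]

/-- `Δ(S(x)) = (S ⊗ S)Δ(x)` up to the flip, in the form
`Δ(S(x))(S(c) ⊗ 1) = σ(S ⊗ S)((1 ⊗ c)Δ(x))`. -/
theorem Antipode.T₃_apply (hS : K.Antipode ε S) (hsurj : Function.Surjective S)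
    (hφ : K.LeftInvariant φ) (hφ₀ : φ ≠ 0) (x c : A) : K.T₃ (S x ⊗ₜ S c) =
      TensorProduct.comm ℂ A A (TensorProduct.map S S (K.T₄ (c ⊗ₜ x))) := by
  apply K.lTensor_mul_right_cancel
  intro d
  obtain ⟨d, rfl⟩ := hsurj d
  have h₁ : ∀ t, (K.mul.flip (S c)).rTensor A (TensorProduct.comm ℂ A A (TensorProduct.map S S t)) =
      TensorProduct.comm ℂ A A (TensorProduct.map S S ((K.mul c).lTensor A t)) := by
    intro t
    induction t with
    | zero => simp
    | add s t hs ht => simp only [map_add, hs, ht]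
    | tmul u v => simp [hS.map_mul]
  have h₂ : ∀ t, (K.mul.flip (S d)).lTensor A (TensorProduct.comm ℂ A A (TensorProduct.map S S t)) =
      TensorProduct.comm ℂ A A (TensorProduct.map S S ((K.mul d).rTensor A t)) := by
    intro t
    induction t with
    | zero => simp
    | add s t hs ht => simp only [map_add, hs, ht]
    | tmul u v => simp [hS.map_mul]
  rw [hS.T₃_apply_mul hφ hφ₀, h₁, h₂, ← K.right_tmul₂, K.right_tmul₄]

/-- S reverses the coproduct, so it carries left invariance of φ to right invariance of φ ∘ S. -/
theorem Antipode.rightInvariant (hS : K.Antipode ε S) (hbij : Function.Bijective S)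
    (hφ : K.LeftInvariant φ) (hφ₀ : φ ≠ 0) : K.RightInvariant (φ ∘ₗ S) := by
  have h₄ : ∀ a b, sliceLeft (φ ∘ₗ S) (K.T₄ (b ⊗ₜ a)) = (φ ∘ₗ S) a • b := by
    intro a b
    apply hbij.1
    rw [← sliceLeft_map, ← sliceRight_comm, ← hS.T₃_apply hbij.2 hφ hφ₀, hφ.T₃, map_smul]
    rfl
  refine ⟨fun a b => ?_, h₄⟩
  apply K.mul_left_cancel
  intro d
  rw [← sliceLeft_lTensor, ← K.T₄_T₁, sliceLeft_lTensor, h₄]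
  simp

/-! #### Functionals given by integrals -/

/-- Apply ψ ⊗ φ to Δ(x)T₁(s) = Δ(x)T₃(t): right invariance evaluates one side, left invariance the
other. -/
theorem mul_sliceRight_eq (hφ : K.LeftInvariant φ) (hψ : K.RightInvariant ψ) {s t : A ⊗[ℂ] A}
    (h : K.T₁ s = K.T₃ t) (x : A) :
    ψ (K.mul x (sliceRight φ s)) = φ (K.mul x (sliceRight ψ t)) := by
  have h₁ : ∀ s, φ (sliceLeft ψ (K.left x (K.T₁ s))) = ψ (K.mul x (sliceRight φ s)) := by
    intro s
    induction s with
    | zero => simp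
    | add s t hs ht => simp only [map_add, hs, ht]
    | tmul p q => rw [K.left_T₁, hψ.T₁]; simp [mul_comm]
  have h₃ : ∀ s, ψ (sliceRight φ (K.left x (K.T₃ s))) = φ (K.mul x (sliceRight ψ s)) := by
    intro s
    induction s with
    | zero => simp
    | add s t hs ht => simp only [map_add, hs, ht]
    | tmul p q => rw [K.left_T₃, hφ.T₃]; simp [mul_comm]
  rw [← h₁, h, ← h₃, apply_sliceRight]

/-- `φ( · p) = ψ( · p')` for some `p'`. -/
theorem exists_right_eq_right (hφ : K.LeftInvariant φ) (hψ : K.RightInvariant ψ) (hψ₀ : ψ ≠ 0)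
    (p : A) : ∃ p', ∀ x, φ (K.mul x p) = ψ (K.mul x p') := by
  obtain ⟨w, hw⟩ := exists_apply_eq_one hψ₀
  -- As ψ(w) = 1, p is the ψ-slice of p ⊗ w; the witness is the φ-slice of the tensor s with T₁(s) =
  -- T₃(p ⊗ w).
  refine ⟨sliceRight φ (K.T₁.symm (K.T₃ (p ⊗ₜ w))), fun x => ?_⟩
  rw [mul_sliceRight_eq hφ hψ (K.T₁.apply_symm_apply _)]
  simp [hw]

/-- `ψ( · p) = φ( · p')` for some `p'`. -/
theorem exists_right_eq_right' (hφ : K.LeftInvariant φ) (hφ₀ : φ ≠ 0) (hψ : K.RightInvariant ψ)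
    (p : A) : ∃ p', ∀ x, ψ (K.mul x p) = φ (K.mul x p') := by
  obtain ⟨w, hw⟩ := exists_apply_eq_one hφ₀
  refine ⟨sliceRight ψ (K.T₃.symm (K.T₁ (p ⊗ₜ w))), fun x => ?_⟩
  rw [← mul_sliceRight_eq hφ hψ (K.T₃.apply_symm_apply _).symm]
  simp [hw]

/-- `φ(p · ) = φ( · p')` for some `p'`. -/
theorem exists_left_eq_right (hS : K.Antipode ε S) (hS' : K.op.Antipode ε S')
    (hφ : K.LeftInvariant φ) (hφ₀ : φ ≠ 0) (p : A) :
    ∃ p', ∀ x, φ (K.mul p x) = φ (K.mul x p') := by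
  have hl := hS.leftInverse_op hS' hφ hφ₀
  have hr := hS.rightInverse_op hS' hφ hφ₀
  -- `S'` is the antipode of `op`, so φ ∘ S' is right invariant there, and right invariance is the
  -- same condition for `op` and K. Reaching any right integral suffices, since its functionals ψ( ·
  -- z) are of the form φ( · p').
  have hψ : K.RightInvariant (φ ∘ₗ S') :=
    K.op_op ▸ (hS'.rightInvariant
      ⟨Function.LeftInverse.injective hr, Function.RightInverse.surjective hl⟩ hφ.op hφ₀).op
  suffices h : ∃ z, ∀ x, φ (K.mul p x) = (φ ∘ₗ S') (K.mul x z) by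
    obtain ⟨z, hz⟩ := h
    obtain ⟨p', hp'⟩ := exists_right_eq_right' hφ hφ₀ hψ z
    exact ⟨p', fun x => (hz x).trans (hp' x)⟩
  obtain ⟨t, rfl⟩ := exists_sliceLeft_T₂ (K := K) hφ₀ p
  induction t with
  | zero => exact ⟨0, by simp⟩
  | add s t hs ht =>
    obtain ⟨y, hy⟩ := hs
    obtain ⟨z, hz⟩ := ht
    exact ⟨y + z, fun x => by simp only [map_add, LinearMap.add_apply, hy, hz]⟩
  | tmul d a =>
    -- The variable x is moved from the right end to the left in four steps: expand p, apply strong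
    -- invariance for φ, then strong invariance for the right integral φ ∘ S', and rewrite φ(aS(y))
    -- as φ(S(yS'(a))).
    refine ⟨sliceRight (φ ∘ₗ S) (K.T₁ (S d ⊗ₜ S' a)), fun x => ?_⟩
    have h₁ : φ (K.mul (sliceLeft φ (K.T₂ (d ⊗ₜ a))) x) =
        φ (K.mul d (sliceRight φ (K.T₁ (a ⊗ₜ x)))) := by
      rw [← sliceRight_rTensor, ← K.T₂_T₁, sliceRight_lTensor, apply_sliceRight]
      rfl
    have h₂ : φ (K.mul d (sliceRight φ (K.T₁ (a ⊗ₜ x)))) =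
        (φ ∘ₗ S') (K.mul (sliceRight φ (K.T₄ (a ⊗ₜ x))) (S d)) := by
      rw [← hS.slice_T₁ hφ, ← hS.map_mul, LinearMap.comp_apply, hl]
    have h₃ : (φ ∘ₗ S') (K.mul (sliceRight φ (K.T₄ (a ⊗ₜ x))) (S d)) =
        φ (K.mul a (S (sliceLeft (φ ∘ₗ S') (K.T₂ (x ⊗ₜ S d))))) := by
      change (φ ∘ₗ S') (K.mul.flip (S d) _) = _
      rw [← sliceRight_rTensor, K.T₄_T₃, sliceRight_lTensor, apply_sliceRight, hS.slice_T₂ hψ]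
      rfl
    have h₄ : φ (K.mul a (S (sliceLeft (φ ∘ₗ S') (K.T₂ (x ⊗ₜ S d))))) =
        (φ ∘ₗ S') (K.mul x (sliceRight (φ ∘ₗ S) (K.T₁ (S d ⊗ₜ S' a)))) := by
      rw [← sliceRight_rTensor, ← K.T₂_T₁, sliceRight_lTensor, apply_sliceRight]
      simp [hS.map_mul, hr]
    rw [h₁, h₂, h₃, h₄]

end CanonicalMaps

/-! ### Multipliers of non-degenerate algebras -/

section Nondegenerate

/-- The product of `X` is non-degenerate. -/
structure Nondegenerate (X : Type*) [NonUnitalRing X] : Prop where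
  left : ∀ a : X, (∀ b, a * b = 0) → a = 0
  right : ∀ a : X, (∀ b, b * a = 0) → a = 0

theorem Nondegenerate.mul_right_cancel {X : Type*} [NonUnitalRing X] (h : Nondegenerate X)
    {a b : X} (hab : ∀ c, a * c = b * c) : a = b :=
  sub_eq_zero.1 (h.left _ fun c => by rw [sub_mul, hab, sub_self])

theorem Nondegenerate.mul_left_cancel {X : Type*} [NonUnitalRing X] (h : Nondegenerate X)
    {a b : X} (hab : ∀ c, c * a = c * b) : a = b :=
  sub_eq_zero.1 (h.right _ fun c => by rw [mul_sub, hab, sub_self])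

variable {X Y : Type*} [NonUnitalRing X] [Module ℂ X] [IsScalarTower ℂ X X] [SMulCommClass ℂ X X]
  [NonUnitalRing Y] [Module ℂ Y] [IsScalarTower ℂ Y Y] [SMulCommClass ℂ Y Y]

theorem Multiplier.mul_left_eq (m : Multiplier X) (x y : X) : x * m.left y = m.right x * y :=
  m.2 x y

@[simp] theorem Multiplier.of_left (x y : X) : (Multiplier.of x).left y = x * y := rfl

@[simp] theorem Multiplier.of_right (x y : X) : (Multiplier.of x).right y = y * x := rfl

@[simp] theorem Multiplier.mul_left (m n : Multiplier X) (x : X) :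
    (m * n).left x = m.left (n.left x) := rfl

@[simp] theorem Multiplier.mul_right (m n : Multiplier X) (x : X) :
    (m * n).right x = n.right (m.right x) := rfl

@[simp] theorem Multiplier.one_left (x : X) : (1 : Multiplier X).left x = x := rfl

@[simp] theorem Multiplier.one_right (x : X) : (1 : Multiplier X).right x = x := rfl

@[simp] theorem Multiplier.tmul_left (m : Multiplier X) (n : Multiplier Y) (x : X) (y : Y) :
    (Multiplier.tmul m n).left (x ⊗ₜ y) = m.left x ⊗ₜ n.left y := rfl

@[simp] theorem Multiplier.tmul_right (m : Multiplier X) (n : Multiplier Y) (x : X) (y : Y) :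
    (Multiplier.tmul m n).right (x ⊗ₜ y) = m.right x ⊗ₜ n.right y := rfl

theorem Multiplier.ext {m n : Multiplier X} (hl : ∀ x, m.left x = n.left x)
    (hr : ∀ x, m.right x = n.right x) : m = n :=
  Subtype.ext (Prod.ext (LinearMap.ext hl) (MulOpposite.unop_injective (LinearMap.ext hr)))

theorem Nondegenerate.tensor (hX : Nondegenerate X) (hY : Nondegenerate Y) :
    Nondegenerate (X ⊗[ℂ] Y) where
  left t h := by
    refine eq_zero_of_lTensor (fun b : Y => LinearMap.mulRight ℂ b) hY.left t fun b => ?_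
    refine eq_zero_of_rTensor (fun a : X => LinearMap.mulRight ℂ a) hX.left _ fun a => ?_
    rw [← h (a ⊗ₜ b)]
    clear h
    induction t with
    | zero => simp
    | add s t hs ht => simp only [map_add, add_mul, hs, ht]
    | tmul x y => simp
  right t h := by
    refine eq_zero_of_lTensor (fun b : Y => LinearMap.mulLeft ℂ b) hY.right t fun b => ?_
    refine eq_zero_of_rTensor (fun a : X => LinearMap.mulLeft ℂ a) hX.right _ fun a => ?_
    rw [← h (a ⊗ₜ b)]
    clear h
    induction t with
    | zero => simp
    | add s t hs ht => simp only [map_add, mul_add, hs, ht]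
    | tmul x y => simp

theorem Nondegenerate.of_injective (h : Nondegenerate X) :
    Function.Injective (Multiplier.of : X → Multiplier X) := fun _ _ hab =>
  h.mul_right_cancel fun c => congrArg (fun m : Multiplier X => m.left c) hab

theorem Nondegenerate.ext_left (h : Nondegenerate X) {m n : Multiplier X}
    (hl : ∀ x, m.left x = n.left x) : m = n :=
  Multiplier.ext hl fun x => h.mul_right_cancel fun y => by
    rw [← m.mul_left_eq, ← n.mul_left_eq, hl]

theorem Nondegenerate.ext_right (h : Nondegenerate X) {m n : Multiplier X}
    (hr : ∀ x, m.right x = n.right x) : m = n :=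
  Multiplier.ext (fun x => h.mul_left_cancel fun y => by
    rw [m.mul_left_eq, n.mul_left_eq, hr]) hr

theorem Nondegenerate.of_left (h : Nondegenerate X) (m : Multiplier X) (x : X) :
    Multiplier.of (m.left x) = m * Multiplier.of x :=
  h.ext_left fun y => h.mul_left_cancel fun z => by
    simp only [Multiplier.of_left, Multiplier.mul_left]
    rw [← mul_assoc, m.mul_left_eq, m.mul_left_eq, mul_assoc]

theorem Nondegenerate.of_right (h : Nondegenerate X) (m : Multiplier X) (x : X) :
    Multiplier.of (m.right x) = Multiplier.of x * m :=
  h.ext_left fun y => by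
    simp only [Multiplier.of_left, Multiplier.mul_left]
    rw [m.mul_left_eq]

theorem tmul_one_mul_one_tmul (m : Multiplier X) (n : Multiplier Y) :
    Multiplier.tmul m 1 * Multiplier.tmul 1 n = Multiplier.tmul 1 n * Multiplier.tmul m 1 := by
  apply Multiplier.ext
  · intro t
    induction t with
    | zero => simp
    | add s t hs ht => simp only [map_add, hs, ht]
    | tmul x y => simp
  · intro t
    induction t with
    | zero => simp
    | add s t hs ht => simp only [map_add, hs, ht]
    | tmul x y => simp

theorem of_tmul (x : X) (y : Y) : Multiplier.of (x ⊗ₜ[ℂ] y) =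
    Multiplier.tmul (Multiplier.of x) 1 * Multiplier.tmul 1 (Multiplier.of y) := by
  apply Multiplier.ext
  · intro t
    induction t with
    | zero => simp
    | add s t hs ht => simp only [map_add, hs, ht]
    | tmul x y => simp
  · intro t
    induction t with
    | zero => simp
    | add s t hs ht => simp only [map_add, hs, ht]
    | tmul x y => simp

theorem tmul_one_left (m : Multiplier X) (t : X ⊗[ℂ] Y) :
    (Multiplier.tmul m (1 : Multiplier Y)).left t = m.left.rTensor Y t := rfl

theorem one_tmul_left (m : Multiplier Y) (t : X ⊗[ℂ] Y) :
    (Multiplier.tmul (1 : Multiplier X) m).left t = m.left.lTensor X t := rfl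

theorem tmul_one_right (m : Multiplier X) (t : X ⊗[ℂ] Y) :
    (Multiplier.tmul m (1 : Multiplier Y)).right t = m.right.rTensor Y t := rfl

theorem one_tmul_right (m : Multiplier Y) (t : X ⊗[ℂ] Y) :
    (Multiplier.tmul (1 : Multiplier X) m).right t = m.right.lTensor X t := rfl

theorem Nondegenerate.of_rTensor_mulLeft (h : Nondegenerate (X ⊗[ℂ] Y)) (d : X) (t : X ⊗[ℂ] Y) :
    Multiplier.of ((LinearMap.mul ℂ X d).rTensor Y t) =
      Multiplier.tmul (Multiplier.of d) 1 * Multiplier.of t := by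
  rw [← h.of_left, tmul_one_left]
  rfl

theorem Nondegenerate.of_lTensor_mulLeft (h : Nondegenerate (X ⊗[ℂ] Y)) (d : Y) (t : X ⊗[ℂ] Y) :
    Multiplier.of ((LinearMap.mul ℂ Y d).lTensor X t) =
      Multiplier.tmul 1 (Multiplier.of d) * Multiplier.of t := by
  rw [← h.of_left, one_tmul_left]
  rfl

theorem Nondegenerate.of_rTensor_mulRight (h : Nondegenerate (X ⊗[ℂ] Y)) (d : X) (t : X ⊗[ℂ] Y) :
    Multiplier.of (((LinearMap.mul ℂ X).flip d).rTensor Y t) =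
      Multiplier.of t * Multiplier.tmul (Multiplier.of d) 1 := by
  rw [← h.of_right, tmul_one_right]
  rfl

theorem Nondegenerate.of_lTensor_mulRight (h : Nondegenerate (X ⊗[ℂ] Y)) (d : Y) (t : X ⊗[ℂ] Y) :
    Multiplier.of (((LinearMap.mul ℂ Y).flip d).lTensor X t) =
      Multiplier.of t * Multiplier.tmul 1 (Multiplier.of d) := by
  rw [← h.of_right, one_tmul_right]
  rfl

/-- An antipode is unique as soon as `a ⊗ b ↦ Δ(a)(1 ⊗ b)` is onto `X ⊗ X`. -/
theorem IsAntipode.eq {Δ : X →ₗ[ℂ] Multiplier (X ⊗[ℂ] X)} (h : Nondegenerate X)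
    {T : X ⊗[ℂ] X →ₗ[ℂ] X ⊗[ℂ] X} (hT : ∀ a b, Multiplier.of (T (a ⊗ₜ b)) =
      Δ a * Multiplier.tmul 1 (Multiplier.of b)) (hsurj : Function.Surjective T)
    {S S' : X →ₗ[ℂ] X} (hS : IsAntipode Δ S) (hS' : IsAntipode Δ S') : S = S' := by
  have hinj := (h.tensor h).of_injective
  have key : ∀ S : X →ₗ[ℂ] X, IsAntipode Δ S → ∃ ε : Module.Dual ℂ X,
      (∀ t, sliceLeft ε (T t) = LinearMap.mul' ℂ X t) ∧
      ∀ t, LinearMap.mul' ℂ X (S.rTensor X (T t)) = sliceLeft ε t := by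
    rintro S ⟨ε, ⟨hε, -⟩, hS, -⟩
    refine ⟨ε, fun t => ?_, fun t => ?_⟩
    · induction t with
      | zero => simp
      | add s t hs ht => simp only [map_add, hs, ht]
      | tmul a b =>
        obtain ⟨t, ht, ht'⟩ := hε a b
        rw [← hT] at ht
        rw [← hinj ht, ht', LinearMap.mul'_apply]
    · induction t with
      | zero => simp
      | add s t hs ht => simp only [map_add, hs, ht]
      | tmul a b =>
        obtain ⟨t, ht, ht'⟩ := hS a b
        rw [← hT] at ht
        rw [← hinj ht, ht', sliceLeft_tmul]
  obtain ⟨ε, h₁, h₂⟩ := key S hS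
  obtain ⟨ε', h₁', h₂'⟩ := key S' hS'
  have hεε : ∀ t : X ⊗[ℂ] X, sliceLeft ε t = sliceLeft ε' t := by
    intro t
    obtain ⟨t, rfl⟩ := hsurj t
    rw [h₁, h₁']
  ext x
  apply h.mul_right_cancel
  intro y
  obtain ⟨t, ht⟩ := hsurj (x ⊗ₜ y)
  have := (h₂ t).trans ((hεε t).trans (h₂' t).symm)
  simpa [ht] using this

end Nondegenerate

/-! ### The canonical maps of an algebraic quantum group -/

namespace RegularMultiplierHopfAlgebra

variable {A : Type*} [NonUnitalRing A] [Module ℂ A] [IsScalarTower ℂ A A] [SMulCommClass ℂ A A]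
  (G : RegularMultiplierHopfAlgebra A)

theorem nondegenerate (G : RegularMultiplierHopfAlgebra A) : Nondegenerate A :=
  ⟨G.eq_zero_of_mul_left, G.eq_zero_of_mul_right⟩

theorem slice_coassoc (f g : Module.Dual ℂ A) (a c d : A) :
    sliceLeft g (G.T₂ (d ⊗ₜ sliceRight f (G.T₁ (a ⊗ₜ c)))) =
      sliceRight f (G.T₁ (sliceLeft g (G.T₂ (d ⊗ₜ a)) ⊗ₜ c)) := by
  have h := congrArg (fun t => sliceRight f (sliceLeft g t)) (G.coassoc d a c)
  have hs : ∀ (t : A ⊗[ℂ] A) (v : A), sliceLeft g (TensorProduct.assoc ℂ A A A (t ⊗ₜ v)) =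
      sliceLeft g t ⊗ₜ v := by
    intro t v
    induction t with
    | zero => simp
    | add s t hs ht => simp only [map_add, TensorProduct.add_tmul, hs, ht]
    | tmul x y => simp [TensorProduct.smul_tmul']
  have hl : ∀ t : A ⊗[ℂ] A, sliceRight f (sliceLeft g (TensorProduct.assoc ℂ A A A
      (G.T₂.toLinearMap.rTensor A ((TensorProduct.assoc ℂ A A A).symm (d ⊗ₜ t))))) =
      sliceLeft g (G.T₂ (d ⊗ₜ sliceRight f t)) := by
    intro t
    induction t with
    | zero => simp
    | add s t hs ht => simp only [map_add, TensorProduct.tmul_add, hs, ht]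
    | tmul x y => simp [hs]
  simp only [hl, sliceLeft_lTensor, hs] at h
  exact h

/-- `(g ⊗ ι)(Δ(a)(d ⊗ 1))`, as a linear map in `a`. -/
def L₃ (g : Module.Dual ℂ A) (d : A) : A →ₗ[ℂ] A :=
  sliceLeft g ∘ₗ G.T₃.toLinearMap ∘ₗ (TensorProduct.mk ℂ A A).flip d

/-- A slice of `coassoc'`; it leads from coassociativity for T₁ and T₂ to the form for T₃ and T₄. -/
theorem L₃_rTensor_T₁ (g : Module.Dual ℂ A) (a d e : A) :
    (G.L₃ g d).rTensor A (G.T₁ (a ⊗ₜ e)) = G.T₁ (G.L₃ g d a ⊗ₜ e) := by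
  have h := congrArg (sliceLeft g) (G.coassoc' a d e)
  have hs : ∀ (t : A ⊗[ℂ] A) (v : A), sliceLeft g (TensorProduct.assoc ℂ A A A (t ⊗ₜ v)) =
      sliceLeft g t ⊗ₜ v := by
    intro t v
    induction t with
    | zero => simp
    | add s t hs ht => simp only [map_add, TensorProduct.add_tmul, hs, ht]
    | tmul x y => simp [TensorProduct.smul_tmul']
  have hl : ∀ t : A ⊗[ℂ] A, sliceLeft g (TensorProduct.assoc ℂ A A A
      ((G.T₃.toLinearMap ∘ₗ (TensorProduct.mk ℂ A A).flip d).rTensor A t)) =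
      (G.L₃ g d).rTensor A t := by
    intro t
    induction t with
    | zero => simp
    | add s t hs ht => simp only [map_add, hs, ht]
    | tmul x y => simp [hs, L₃]
  rw [hl, sliceLeft_lTensor] at h
  exact h

theorem T₄_T₁ (d a c : A) : ((LinearMap.mul ℂ A).flip c).lTensor A (G.T₄ (d ⊗ₜ a)) =
    (LinearMap.mul ℂ A d).lTensor A (G.T₁ (a ⊗ₜ c)) := by
  have h := G.nondegenerate.tensor G.nondegenerate
  apply h.of_injective
  rw [h.of_lTensor_mulRight, h.of_lTensor_mulLeft, G.T₄_spec, G.T₁_spec, mul_assoc]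

/-- A right factor e on the second leg replaces T₄ by T₁, and non-degeneracy removes it again. -/
theorem L₃_rTensor_T₄ (g : Module.Dual ℂ A) (a c d : A) :
    (G.L₃ g d).rTensor A (G.T₄ (c ⊗ₜ a)) = G.T₄ (c ⊗ₜ G.L₃ g d a) := by
  rw [← sub_eq_zero]
  refine eq_zero_of_lTensor (fun e : A => (LinearMap.mul ℂ A).flip e) G.eq_zero_of_mul_left _
    fun e => ?_
  have hcomm : ∀ (p q : A →ₗ[ℂ] A) (t : A ⊗[ℂ] A),
      p.lTensor A (q.rTensor A t) = q.rTensor A (p.lTensor A t) := by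
    intro p q t
    induction t with
    | zero => simp
    | add s t hs ht => simp only [map_add, hs, ht]
    | tmul x y => simp
  rw [map_sub, sub_eq_zero, hcomm, G.T₄_T₁, ← hcomm, G.L₃_rTensor_T₁, G.T₄_T₁]

/-- The canonical maps of a regular multiplier Hopf algebra. -/
def canonicalMaps : CanonicalMaps A :=
  have h := G.nondegenerate.tensor G.nondegenerate
  { mul := LinearMap.mul ℂ A
    assoc := mul_assoc
    eq_zero_left := G.eq_zero_of_mul_left
    eq_zero_right := G.eq_zero_of_mul_right
    T₁ := G.T₁
    T₂ := G.T₂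
    T₃ := G.T₃
    T₄ := G.T₄
    left := fun a => (G.Δ a).left
    right := fun a => (G.Δ a).right
    T₂_T₁ := fun d a c => h.of_injective <| by
      rw [h.of_lTensor_mulRight, h.of_rTensor_mulLeft, G.T₂_spec, G.T₁_spec, mul_assoc]
    T₂_T₃ := G.T₂_T₃
    T₄_T₁ := G.T₄_T₁
    T₄_T₃ := fun d a c => h.of_injective <| by
      rw [h.of_rTensor_mulRight, h.of_lTensor_mulLeft, G.T₄_spec, G.T₃_spec, mul_assoc]
    left_tmul₁ := G.Δ_left_tmul
    left_tmul₃ := G.Δ_left_tmul'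
    right_tmul₂ := fun a u v => h.of_injective <| by
      rw [h.of_right, h.of_lTensor_mulLeft, G.T₂_spec, of_tmul, tmul_one_mul_one_tmul, mul_assoc]
    right_tmul₄ := fun a u v => h.of_injective <| by
      rw [h.of_right, h.of_rTensor_mulLeft, G.T₄_spec, of_tmul, mul_assoc]
    left_T₁ := fun a b c => h.of_injective <| by
      rw [h.of_left, G.T₁_spec, G.T₁_spec, LinearMap.mul_apply', map_mul, mul_assoc]
    left_T₃ := G.Δ_left_T₃
    right_T₂ := fun a b c => h.of_injective <| by
      rw [h.of_right, G.T₂_spec, G.T₂_spec, LinearMap.mul_apply', map_mul, mul_assoc]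
    right_T₄ := fun a b c => h.of_injective <| by
      rw [h.of_right, G.T₄_spec, G.T₄_spec, LinearMap.mul_apply', map_mul, mul_assoc]
    coassoc₁₂ := G.slice_coassoc
    coassoc₃₄ := fun f g a c d => by
      have h := congrArg (sliceRight f) (G.L₃_rTensor_T₄ g a c d)
      rwa [sliceRight_rTensor] at h }

end RegularMultiplierHopfAlgebra

/-! ### Integrals and the antipode of an algebraic quantum group -/

namespace AlgebraicQuantumGroup

variable {A : Type*} [NonUnitalRing A] [Module ℂ A] [IsScalarTower ℂ A A] [SMulCommClass ℂ A A]
  (G : AlgebraicQuantumGroup A)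

theorem leftInvariant : G.canonicalMaps.LeftInvariant G.φ := ⟨G.left_invariant', G.left_invariant⟩

theorem exists_counit_antipode : ∃ (ε : Module.Dual ℂ A) (S S' : A →ₗ[ℂ] A),
    G.canonicalMaps.Antipode ε S ∧ G.canonicalMaps.op.Antipode ε S' := by
  obtain ⟨ε, hε⟩ := G.canonicalMaps.exists_counit
    ⟨G.φ, exists_apply_eq_one G.φ_ne_zero⟩
  obtain ⟨S, hS⟩ := CanonicalMaps.exists_antipode hε G.leftInvariant G.φ_ne_zero
  obtain ⟨S', hS'⟩ := CanonicalMaps.exists_antipode hε.op G.leftInvariant.op G.φ_ne_zero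
  exact ⟨ε, S, S', hS, hS'⟩

/-- The counit of `A`. -/
def ε : Module.Dual ℂ A := G.exists_counit_antipode.choose

/-- The antipode of `A`. -/
def S : A →ₗ[ℂ] A := G.exists_counit_antipode.choose_spec.choose

/-- The inverse of the antipode of `A`. -/
def Sinv : A →ₗ[ℂ] A := G.exists_counit_antipode.choose_spec.choose_spec.choose

theorem antipode : G.canonicalMaps.Antipode G.ε G.S :=
  G.exists_counit_antipode.choose_spec.choose_spec.choose_spec.1

theorem antipode_op : G.canonicalMaps.op.Antipode G.ε G.Sinv :=
  G.exists_counit_antipode.choose_spec.choose_spec.choose_spec.2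

@[simp] theorem Sinv_S (x : A) : G.Sinv (G.S x) = x :=
  G.antipode.leftInverse_op G.antipode_op G.leftInvariant G.φ_ne_zero x

@[simp] theorem S_Sinv (x : A) : G.S (G.Sinv x) = x :=
  G.antipode.rightInverse_op G.antipode_op G.leftInvariant G.φ_ne_zero x

theorem S_bijective : Function.Bijective G.S :=
  ⟨Function.LeftInverse.injective G.Sinv_S, Function.RightInverse.surjective G.S_Sinv⟩

theorem Sinv_bijective : Function.Bijective G.Sinv :=
  ⟨Function.LeftInverse.injective G.S_Sinv, Function.RightInverse.surjective G.Sinv_S⟩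

theorem S_mul (x y : A) : G.S (x * y) = G.S y * G.S x := G.antipode.map_mul x y

theorem isAntipode : IsAntipode (G.Δ : A →ₗ[ℂ] Multiplier (A ⊗[ℂ] A)) G.S := by
  have h := G.antipode
  refine ⟨G.ε, ⟨fun a b => ⟨_, G.T₁_spec a b, ?_⟩, fun a b => ⟨_, G.T₂_spec a b, ?_⟩⟩,
    fun a b => ⟨_, G.T₁_spec a b, ?_⟩, fun a b => ⟨_, G.T₂_spec a b, ?_⟩⟩
  · exact (h.counit.T₁ (a ⊗ₜ b)).trans (CanonicalMaps.m_tmul _ _ _)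
  · exact (h.counit.T₂ (a ⊗ₜ b)).trans (CanonicalMaps.m_tmul _ _ _)
  · exact (h.T₁ (a ⊗ₜ b)).trans (sliceLeft_tmul _ _ _)
  · exact (h.T₂ (a ⊗ₜ b)).trans (sliceRight_tmul _ _ _)

theorem isThe_antipode :
    IsThe (IsAntipode (G.Δ : A →ₗ[ℂ] Multiplier (A ⊗[ℂ] A))) G.S :=
  ⟨G.isAntipode, fun _ h => IsAntipode.eq G.nondegenerate (T := G.T₁.toLinearMap) G.T₁_spec
    G.T₁.surjective h G.isAntipode⟩

/-- The right integral `φ ∘ S`. -/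
def ψ : Module.Dual ℂ A := G.φ ∘ₗ G.S

theorem ψ_apply (x : A) : G.ψ x = G.φ (G.S x) := rfl

theorem rightInvariant : G.canonicalMaps.RightInvariant G.ψ :=
  G.antipode.rightInvariant G.S_bijective G.leftInvariant G.φ_ne_zero

theorem ψ_ne_zero : G.ψ ≠ 0 := fun h => G.φ_ne_zero <| LinearMap.ext fun x => by
  have := LinearMap.congr_fun h (G.Sinv x)
  simpa [ψ] using this

theorem S_slice_T₁ (t : A ⊗[ℂ] A) : G.S (sliceRight G.φ (G.T₁ t)) = sliceRight G.φ (G.T₄ t) :=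
  G.antipode.slice_T₁ G.leftInvariant t

theorem S_slice_T₂ (t : A ⊗[ℂ] A) : G.S (sliceLeft G.ψ (G.T₂ t)) = sliceLeft G.ψ (G.T₃ t) :=
  G.antipode.slice_T₂ G.rightInvariant t

theorem eq_zero_of_φ_mul_right {a : A} (h : ∀ x, G.φ (x * a) = 0) : a = 0 :=
  CanonicalMaps.faithful_right G.antipode G.S_bijective.2 G.leftInvariant G.φ_ne_zero h

theorem eq_zero_of_φ_mul_left {a : A} (h : ∀ x, G.φ (a * x) = 0) : a = 0 :=
  CanonicalMaps.faithful_right G.antipode_op G.Sinv_bijective.2 G.leftInvariant.op G.φ_ne_zero h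

theorem exists_φ_left_eq (p : A) : ∃ p', ∀ x, G.φ (p * x) = G.φ (x * p') :=
  CanonicalMaps.exists_left_eq_right G.antipode G.antipode_op G.leftInvariant G.φ_ne_zero p

theorem exists_φ_right_eq (p : A) : ∃ p', ∀ x, G.φ (x * p) = G.φ (p' * x) :=
  CanonicalMaps.exists_left_eq_right G.antipode_op (G.canonicalMaps.op_op.symm ▸ G.antipode)
    G.leftInvariant.op G.φ_ne_zero p

/-- In the opposite algebra ψ(p · ) is a functional with p on the right, so the exchange of
integrals applies there and gives φ(q · ). -/
theorem exists_ψ_left_eq (p : A) : ∃ p', ∀ x, G.ψ (p * x) = G.φ (x * p') := by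
  obtain ⟨q, hq⟩ := CanonicalMaps.exists_right_eq_right' G.leftInvariant.op G.φ_ne_zero
    G.rightInvariant.op p
  obtain ⟨p', hp'⟩ := G.exists_φ_left_eq q
  exact ⟨p', fun x => (hq x).trans (hp' x)⟩

theorem exists_φ_right_eq_ψ (p : A) : ∃ p', ∀ x, G.φ (x * p) = G.ψ (p' * x) := by
  obtain ⟨q, hq⟩ := G.exists_φ_right_eq p
  obtain ⟨p', hp'⟩ := CanonicalMaps.exists_right_eq_right G.leftInvariant.op G.rightInvariant.op
    G.ψ_ne_zero q
  exact ⟨p', fun x => (hq x).trans (hp' x)⟩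

/-! ### Elements of the dual -/

/-- `F c = φ( · c)`, as a linear equivalence. -/
def F : A ≃ₗ[ℂ] G.Dual := LinearEquiv.ofBijective G.toDual
  ⟨(injective_iff_map_eq_zero G.toDual).2 fun c hc => G.eq_zero_of_φ_mul_right fun x => by
    rw [← G.ev_toDual, hc]
    simp, G.toDual_surjective⟩

@[simp] theorem ev_F (c x : A) : G.ev (G.F c) x = G.φ (x * c) := rfl

/-- The functional `φ(d · )`. -/
def Φ : A →ₗ[ℂ] G.Dual :=
  LinearMap.codRestrict (LinearMap.range G.fourier) ((LinearMap.mul ℂ A).compr₂ G.φ) fun d => by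
    obtain ⟨p, hp⟩ := G.exists_φ_left_eq d
    exact ⟨p, LinearMap.ext fun x => (hp x).symm⟩

@[simp] theorem ev_Φ (d x : A) : G.ev (G.Φ d) x = G.φ (d * x) := rfl

/-- The functional `ψ(d · )`. -/
def Ψ : A →ₗ[ℂ] G.Dual :=
  LinearMap.codRestrict (LinearMap.range G.fourier) ((LinearMap.mul ℂ A).compr₂ G.ψ) fun d => by
    obtain ⟨p, hp⟩ := G.exists_ψ_left_eq d
    exact ⟨p, LinearMap.ext fun x => (hp x).symm⟩

@[simp] theorem ev_Ψ (d x : A) : G.ev (G.Ψ d) x = G.ψ (d * x) := rfl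

theorem Φ_surjective : Function.Surjective G.Φ := by
  intro b
  obtain ⟨c, rfl⟩ := G.F.surjective b
  obtain ⟨p, hp⟩ := G.exists_φ_right_eq c
  exact ⟨p, G.ev_ext fun x => (hp x).symm⟩

theorem Ψ_surjective : Function.Surjective G.Ψ := by
  intro b
  obtain ⟨c, rfl⟩ := G.F.surjective b
  obtain ⟨p, hp⟩ := G.exists_φ_right_eq_ψ c
  exact ⟨p, G.ev_ext fun x => (hp x).symm⟩

theorem eq_of_ev {x y : A} (h : ∀ b, G.ev b x = G.ev b y) : x = y :=
  sub_eq_zero.1 <| G.eq_zero_of_φ_mul_left fun c => by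
    rw [← G.ev_F, map_sub, h, sub_self]

/-- The action `b ▷ x = (ι ⊗ b)Δ(x)` of `B` on `A`. -/
def lact (b : G.Dual) : A →ₗ[ℂ] A :=
  sliceRight G.φ ∘ₗ G.T₁.toLinearMap ∘ₗ (TensorProduct.mk ℂ A A).flip (G.F.symm b)

/-- The action `x ◁ b = (b ⊗ ι)Δ(x)` of `B` on `A`. -/
def ract (b : G.Dual) : A →ₗ[ℂ] A :=
  sliceLeft G.φ ∘ₗ G.T₃.toLinearMap ∘ₗ (TensorProduct.mk ℂ A A).flip (G.F.symm b)

theorem lact_F (c x : A) : G.lact (G.F c) x = sliceRight G.φ (G.T₁ (x ⊗ₜ c)) := by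
  simp [lact]

theorem ract_F (c x : A) : G.ract (G.F c) x = sliceLeft G.φ (G.T₃ (x ⊗ₜ c)) := by
  simp [ract]

theorem ev_lact (b b' : G.Dual) (x : A) : G.ev b' (G.lact b x) = G.ev (b' * b) x := by
  obtain ⟨c, rfl⟩ := G.F.surjective b
  rw [lact_F]
  exact ((G.ev_mul b' c x).trans (dualDistrib_apply _ _ _)).symm

theorem ev_ract (b b' : G.Dual) (x : A) : G.ev b' (G.ract b x) = G.ev (b * b') x := by
  obtain ⟨c, rfl⟩ := G.F.surjective b
  rw [ract_F, ← apply_sliceRight]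
  exact ((G.ev_mul' c b' x).trans (dualDistrib_apply _ _ _)).symm

theorem lact_mul (b b' : G.Dual) (x : A) : G.lact (b * b') x = G.lact b (G.lact b' x) :=
  G.eq_of_ev fun c => by simp only [ev_lact, mul_assoc]

theorem ract_mul (b b' : G.Dual) (x : A) : G.ract (b * b') x = G.ract b' (G.ract b x) :=
  G.eq_of_ev fun c => by simp only [ev_ract, mul_assoc]

theorem lact_ract (b b' : G.Dual) (x : A) : G.lact b (G.ract b' x) = G.ract b' (G.lact b x) :=
  G.eq_of_ev fun c => by simp only [ev_ract, ev_lact, mul_assoc]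

/-- Paired with φ( · c), both sides are (φ ⊗ φ)((1 ⊗ e)Δ(x)(c ⊗ 1)). -/
theorem lact_Φ (e x : A) : G.lact (G.Φ e) x = sliceRight G.φ (G.T₄ (e ⊗ₜ x)) := by
  apply G.eq_of_ev
  intro b
  obtain ⟨c, rfl⟩ := G.F.surjective b
  rw [ev_lact, ← ev_ract, ract_F, ev_Φ, ev_F]
  have h := congrArg (fun t => G.φ (sliceRight G.φ t)) (G.canonicalMaps.T₄_T₃ e x c)
  simp only [sliceRight_rTensor, sliceRight_lTensor, apply_sliceRight (G.φ) (G.φ ∘ₗ _)] at h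
  exact h.symm

theorem ract_Ψ (d x : A) : G.ract (G.Ψ d) x = sliceLeft G.ψ (G.T₂ (d ⊗ₜ x)) := by
  apply G.eq_of_ev
  intro b
  obtain ⟨c, rfl⟩ := G.F.surjective b
  rw [ev_ract, ← ev_lact, lact_F, ev_Ψ, ev_F]
  have h := congrArg (fun t => G.ψ (sliceRight G.φ t)) (G.canonicalMaps.T₂_T₁ d x c)
  simp only [sliceRight_rTensor, sliceRight_lTensor, apply_sliceRight (G.ψ) (G.φ ∘ₗ _)] at h
  exact h.symm

theorem lact_induction (x : A) (P : A → Prop) (h0 : P 0) (hadd : ∀ x y, P x → P y → P (x + y))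
    (h : ∀ b y, P (G.lact b y)) : P x := by
  obtain ⟨t, rfl⟩ := CanonicalMaps.exists_sliceRight_T₁ (K := G.canonicalMaps) G.φ_ne_zero x
  induction t with
  | zero => simpa using h0
  | add s t hs ht => rw [map_add, map_add]; exact hadd _ _ hs ht
  | tmul y c => exact G.lact_F c y ▸ h (G.F c) y

/-- An element annihilating `B` by multiplication vanishes on B ▷ A or on A ◁ B, and both span A
because T₁ and T₃ are onto and φ ≠ 0. -/
theorem nondegenerate_dual : Nondegenerate G.Dual where
  left b hb := by
    apply G.ev_ext
    intro x
    induction x using G.lact_induction with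
    | h0 => simp
    | hadd x y hx hy => rw [map_add, map_add, hx, hy]
    | h b' y => rw [ev_lact, hb]; simp
  right b hb := by
    apply G.ev_ext
    intro x
    obtain ⟨w, hw⟩ := exists_apply_eq_one G.φ_ne_zero
    have h : ∀ t, G.ev b (sliceLeft G.φ (G.T₃ t)) = 0 := by
      intro t
      induction t with
      | zero => simp
      | add s t hs ht => simp only [map_add, hs, ht, add_zero]
      | tmul y c => rw [← ract_F, ev_ract, hb]; simp
    have := h (G.T₃.symm (w ⊗ₜ x))
    simpa [hw] using this

/-- `(φ( · c) ▷ y)a = (φ(y · ) ⊗ ι)(T₃⁻¹(a ⊗ c))`. -/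
theorem lact_F_mul (c y a : A) : G.lact (G.F c) y * a =
    sliceLeft (G.φ ∘ₗ LinearMap.mul ℂ A y) (G.T₃.symm (a ⊗ₜ c)) := by
  -- As Δ(y)T₃(p ⊗ q) = T₃(yp ⊗ q), left invariance leaves φ(yp)q. The formula results on taking t =
  -- T₃⁻¹(a ⊗ c).
  have h : ∀ t, sliceRight G.φ (G.canonicalMaps.left y (G.T₃ t)) =
      sliceLeft (G.φ ∘ₗ LinearMap.mul ℂ A y) t := by
    intro t
    induction t with
    | zero => simp
    | add s t hs ht => simp only [map_add, hs, ht]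
    | tmul p q =>
      refine (congrArg (sliceRight G.φ) (G.canonicalMaps.left_T₃ y p q)).trans ?_
      exact G.left_invariant _ _
  rw [← h, LinearEquiv.apply_symm_apply, G.canonicalMaps.left_tmul₁, sliceRight_rTensor, lact_F]
  rfl

/-- `a(y ◁ ψ(d · )) = (ι ⊗ ψ( · y))(T₄⁻¹(d ⊗ a))`. -/
theorem mul_ract_Ψ (d y a : A) : a * G.ract (G.Ψ d) y =
    sliceRight (G.ψ ∘ₗ (LinearMap.mul ℂ A).flip y) (G.T₄.symm (d ⊗ₜ a)) := by
  have h : ∀ t, sliceLeft G.ψ (G.canonicalMaps.right y (G.T₄ t)) =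
      sliceRight (G.ψ ∘ₗ (LinearMap.mul ℂ A).flip y) t := by
    intro t
    induction t with
    | zero => simp
    | add s t hs ht => simp only [map_add, hs, ht]
    | tmul p q =>
      refine (congrArg (sliceLeft G.ψ) (G.canonicalMaps.right_T₄ y q p)).trans ?_
      exact G.rightInvariant.T₄ _ _
  rw [← h, LinearEquiv.apply_symm_apply, G.canonicalMaps.right_tmul₂, sliceLeft_lTensor, ract_Ψ]
  rfl

/-- `S(φ( · c) ▷ x)a = (ι ⊗ φ(x · ))(Δ(c)(a ⊗ 1))`. -/
theorem S_lact_F_mul (c x a : A) : G.S (G.lact (G.F c) x) * a =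
    sliceRight (G.φ ∘ₗ LinearMap.mul ℂ A x) (G.T₃ (c ⊗ₜ a)) := by
  rw [lact_F, S_slice_T₁, ← sliceRight_lTensor]
  refine Eq.trans ?_ (congrArg (sliceRight G.φ) (G.canonicalMaps.T₄_T₃ x c a))
  rw [sliceRight_rTensor]
  rfl

/-- `aS(x ◁ ψ(d · )) = (ψ( · x) ⊗ ι)((1 ⊗ a)Δ(d))`. -/
theorem mul_S_ract_Ψ (d x a : A) : a * G.S (G.ract (G.Ψ d) x) =
    sliceLeft (G.ψ ∘ₗ (LinearMap.mul ℂ A).flip x) (G.T₄ (a ⊗ₜ d)) := by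
  rw [ract_Ψ, S_slice_T₂, ← sliceLeft_rTensor]
  refine Eq.trans ?_ (congrArg (sliceLeft G.ψ) (G.canonicalMaps.T₄_T₃ a d x)).symm
  rw [sliceLeft_lTensor]
  rfl

end AlgebraicQuantumGroup

/-! ### Non-degenerate pairings and multipliers -/

section Pairings

set_option linter.unusedSectionVars false

variable {X Y X' Y' : Type*} [NonUnitalRing X] [Module ℂ X] [IsScalarTower ℂ X X]
  [SMulCommClass ℂ X X] [NonUnitalRing X'] [Module ℂ X'] [IsScalarTower ℂ X' X']
  [SMulCommClass ℂ X' X'] [AddCommGroup Y] [Module ℂ Y] [AddCommGroup Y'] [Module ℂ Y']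
  {p : X →ₗ[ℂ] Module.Dual ℂ Y} {q : X' →ₗ[ℂ] Module.Dual ℂ Y'}

/-- The pairing of the algebra `X` with `Y` is non-degenerate, and `X` acts on `Y` from both
sides. -/
structure IsModulePairing (p : X →ₗ[ℂ] Module.Dual ℂ Y) : Prop where
  inj : ∀ x, (∀ y, p x y = 0) → x = 0
  sep : ∀ y, (∀ x, p x y = 0) → y = 0
  leftAct : ∀ x y, ∃ z, IsLeftAct p x y z
  rightAct : ∀ x y, ∃ z, IsRightAct p x y z

theorem IsModulePairing.ext (hp : IsModulePairing p) {x x' : X} (h : ∀ y, p x y = p x' y) :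
    x = x' :=
  sub_eq_zero.1 (hp.inj _ fun y => by rw [map_sub, LinearMap.sub_apply, h, sub_self])

theorem IsModulePairing.ext' (hp : IsModulePairing p) {y y' : Y} (h : ∀ x, p x y = p x y') :
    y = y' :=
  sub_eq_zero.1 (hp.sep _ fun x => by rw [map_sub, h, sub_self])

theorem IsLeftAct.add_left {x x' : X} {y z z' : Y} (h : IsLeftAct p x y z)
    (h' : IsLeftAct p x' y z') : IsLeftAct p (x + x') y (z + z') := fun w => by
  rw [map_add, h, h', mul_add, map_add, LinearMap.add_apply]

theorem IsLeftAct.add_right {x : X} {y y' z z' : Y} (h : IsLeftAct p x y z)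
    (h' : IsLeftAct p x y' z') : IsLeftAct p x (y + y') (z + z') := fun w => by
  rw [map_add, h, h', map_add]

theorem IsLeftAct.smul_left {x : X} {y z : Y} (r : ℂ) (h : IsLeftAct p x y z) :
    IsLeftAct p (r • x) y (r • z) := fun w => by
  rw [map_smul, h, mul_smul_comm, map_smul, LinearMap.smul_apply]

theorem IsRightAct.add_left {x x' : X} {y z z' : Y} (h : IsRightAct p x y z)
    (h' : IsRightAct p x' y z') : IsRightAct p (x + x') y (z + z') := fun w => by
  rw [map_add, h, h', add_mul, map_add, LinearMap.add_apply]

theorem IsRightAct.add_right {x : X} {y y' z z' : Y} (h : IsRightAct p x y z)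
    (h' : IsRightAct p x y' z') : IsRightAct p x (y + y') (z + z') := fun w => by
  rw [map_add, h, h', map_add]

theorem IsRightAct.smul_left {x : X} {y z : Y} (r : ℂ) (h : IsRightAct p x y z) :
    IsRightAct p (r • x) y (r • z) := fun w => by
  rw [map_smul, h, smul_mul_assoc, map_smul, LinearMap.smul_apply]

theorem tensorPairing_apply (t : X ⊗[ℂ] X') (y : Y) (y' : Y') :
    tensorPairing p q t (y ⊗ₜ y') = q (sliceLeft (p.flip y) t) y' := by
  induction t with
  | zero => simp
  | add s t hs ht => simp only [map_add, LinearMap.add_apply, hs, ht]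
  | tmul x x' => simp [tensorPairing]

@[simp] theorem tensorPairing_tmul (x : X) (x' : X') (y : Y) (y' : Y') :
    tensorPairing p q (x ⊗ₜ x') (y ⊗ₜ y') = p x y * q x' y' := by
  simp [tensorPairing]

theorem tensorPairing_tmul_apply (x : X) (x' : X') (s : Y ⊗[ℂ] Y') :
    tensorPairing p q (x ⊗ₜ x') s = q x' (sliceLeft (p x) s) := by
  induction s with
  | zero => simp
  | add s t hs ht => simp only [map_add, hs, ht]
  | tmul y y' => simp

theorem ext_tensorPairing (hp : IsModulePairing p) (hq : IsModulePairing q) {t t' : X ⊗[ℂ] X'}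
    (h : ∀ y y', tensorPairing p q t (y ⊗ₜ y') = tensorPairing p q t' (y ⊗ₜ y')) : t = t' := by
  apply ext_sliceRight
  intro f
  apply hp.ext
  intro y
  change p.flip y _ = p.flip y _
  rw [apply_sliceRight, apply_sliceRight]
  congr 1
  apply hq.ext
  intro y'
  rw [← tensorPairing_apply, ← tensorPairing_apply, h]

theorem IsLeftAct.tmul {x : X} {x' : X'} {y z : Y} {y' z' : Y'} (h : IsLeftAct p x y z)
    (h' : IsLeftAct q x' y' z') :
    IsLeftAct (tensorPairing p q) (x ⊗ₜ x') (y ⊗ₜ y') (z ⊗ₜ z') := fun t => by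
  induction t with
  | zero => simp
  | add s t hs ht => simp only [map_add, add_mul, LinearMap.add_apply, hs, ht]
  | tmul u u' => simp [h u, h' u']

theorem IsRightAct.tmul {x : X} {x' : X'} {y z : Y} {y' z' : Y'} (h : IsRightAct p x y z)
    (h' : IsRightAct q x' y' z') :
    IsRightAct (tensorPairing p q) (x ⊗ₜ x') (y ⊗ₜ y') (z ⊗ₜ z') := fun t => by
  induction t with
  | zero => simp
  | add s t hs ht => simp only [map_add, mul_add, LinearMap.add_apply, hs, ht]
  | tmul u u' => simp [h u, h' u']

theorem IsModulePairing.tensor (hp : IsModulePairing p) (hq : IsModulePairing q) :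
    IsModulePairing (tensorPairing p q) where
  inj t h := ext_tensorPairing hp hq fun y y' => by rw [h]; simp
  sep s h := by
    apply ext_sliceRight
    intro f
    apply hp.ext'
    intro x
    rw [apply_sliceRight, map_zero, map_zero]
    have : sliceLeft (p x) s = 0 := by
      apply hq.sep
      intro x'
      rw [← tensorPairing_tmul_apply, h]
    rw [this, map_zero]
  leftAct t s := by
    induction s with
    | zero => exact ⟨0, fun t => by simp⟩
    | add s s' hs hs' =>
      obtain ⟨z, hz⟩ := hs
      obtain ⟨z', hz'⟩ := hs'
      exact ⟨_, hz.add_right hz'⟩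
    | tmul y y' =>
      induction t with
      | zero => exact ⟨0, fun t => by simp⟩
      | add s s' hs hs' =>
        obtain ⟨z, hz⟩ := hs
        obtain ⟨z', hz'⟩ := hs'
        exact ⟨_, hz.add_left hz'⟩
      | tmul x x' =>
        obtain ⟨z, hz⟩ := hp.leftAct x y
        obtain ⟨z', hz'⟩ := hq.leftAct x' y'
        exact ⟨_, hz.tmul hz'⟩
  rightAct t s := by
    induction s with
    | zero => exact ⟨0, fun t => by simp⟩
    | add s s' hs hs' =>
      obtain ⟨z, hz⟩ := hs
      obtain ⟨z', hz'⟩ := hs'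
      exact ⟨_, hz.add_right hz'⟩
    | tmul y y' =>
      induction t with
      | zero => exact ⟨0, fun t => by simp⟩
      | add s s' hs hs' =>
        obtain ⟨z, hz⟩ := hs
        obtain ⟨z', hz'⟩ := hs'
        exact ⟨_, hz.add_left hz'⟩
      | tmul x x' =>
        obtain ⟨z, hz⟩ := hp.rightAct x y
        obtain ⟨z', hz'⟩ := hq.rightAct x' y'
        exact ⟨_, hz.tmul hz'⟩

/-- A multiplier is determined by its pairings. -/
theorem IsModulePairing.multiplier_eq (hp : IsModulePairing p) {n n' : Multiplier X}
    {f : Module.Dual ℂ Y} (h : IsExtendedPairing p n f) (h' : IsExtendedPairing p n' f) :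
    n = n' := by
  apply Multiplier.ext
  · intro x
    apply hp.ext
    intro y
    obtain ⟨z, hz⟩ := hp.leftAct x y
    rw [← h.1 x y z hz, ← h'.1 x y z hz]
  · intro x
    apply hp.ext
    intro y
    obtain ⟨z, hz⟩ := hp.rightAct x y
    rw [← h.2 x y z hz, ← h'.2 x y z hz]

/-- A functional `f` on `Y` is given by a multiplier of `X` as soon as the functionals `f(x ▷ · )`
and `f( · ◁ x)` are given by elements of `X`. -/
theorem IsModulePairing.exists_multiplier (hp : IsModulePairing p) (f : Module.Dual ℂ Y)
    (hl : ∀ x, ∃ t, ∀ y z, IsLeftAct p x y z → f z = p t y)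
    (hr : ∀ x, ∃ t, ∀ y z, IsRightAct p x y z → f z = p t y) :
    ∃ n, IsExtendedPairing p n f := by
  choose l hl using hl
  choose r hr using hr
  let L : X →ₗ[ℂ] X :=
    { toFun := l
      map_add' := fun x x' => hp.ext fun y => by
        obtain ⟨z, hz⟩ := hp.leftAct x y
        obtain ⟨z', hz'⟩ := hp.leftAct x' y
        rw [← hl _ _ _ (hz.add_left hz'), map_add, hl _ _ _ hz, hl _ _ _ hz', map_add,
          LinearMap.add_apply]
      map_smul' := fun r x => hp.ext fun y => by
        obtain ⟨z, hz⟩ := hp.leftAct x y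
        rw [← hl _ _ _ (hz.smul_left r), map_smul, hl _ _ _ hz]
        simp }
  let R : X →ₗ[ℂ] X :=
    { toFun := r
      map_add' := fun x x' => hp.ext fun y => by
        obtain ⟨z, hz⟩ := hp.rightAct x y
        obtain ⟨z', hz'⟩ := hp.rightAct x' y
        rw [← hr _ _ _ (hz.add_left hz'), map_add, hr _ _ _ hz, hr _ _ _ hz', map_add,
          LinearMap.add_apply]
      map_smul' := fun r x => hp.ext fun y => by
        obtain ⟨z, hz⟩ := hp.rightAct x y
        rw [← hr _ _ _ (hz.smul_left r), map_smul, hr _ _ _ hz]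
        simp }
  refine ⟨⟨(L, MulOpposite.op R), fun x y => hp.ext fun w => ?_⟩, fun x y z h => hl x y z h,
    fun x y z h => hr x y z h⟩
  -- Both sides of the compatibility condition evaluate f at y ▷ (w ◁ x) = (y ▷ w) ◁ x.
  obtain ⟨u, hu⟩ := hp.rightAct x w
  obtain ⟨v, hv⟩ := hp.leftAct y u
  obtain ⟨u', hu'⟩ := hp.leftAct y w
  obtain ⟨v', hv'⟩ := hp.rightAct x u'
  have hvv : v = v' := hp.ext' fun s => by
    rw [hv s, hu, hv' s, hu', mul_assoc]
  change p (x * l y) w = p (r x * y) w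
  rw [← hu, ← hl _ _ _ hv, ← hu', ← hr _ _ _ hv', hvv]

/-- Elementary tensors suffice: non-degeneracy makes the result of an action unique, so it splits
along sums in either argument. -/
theorem IsModulePairing.exists_multiplier_tensor (hp : IsModulePairing p) (hq : IsModulePairing q)
    (f : Module.Dual ℂ (Y ⊗[ℂ] Y'))
    (hl : ∀ x x', ∃ t, ∀ y y' z z', IsLeftAct p x y z → IsLeftAct q x' y' z' →
      f (z ⊗ₜ z') = tensorPairing p q t (y ⊗ₜ y'))
    (hr : ∀ x x', ∃ t, ∀ y y' z z', IsRightAct p x y z → IsRightAct q x' y' z' →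
      f (z ⊗ₜ z') = tensorPairing p q t (y ⊗ₜ y')) :
    ∃ n, IsExtendedPairing (tensorPairing p q) n f := by
  have hpq := hp.tensor hq
  apply hpq.exists_multiplier
  · intro x
    induction x with
    | zero => exact ⟨0, fun y z h => by
        have : z = 0 := hpq.sep _ fun x => by rw [h x]; simp
        simp [this]⟩
    | add x x' hx hx' =>
      obtain ⟨t, ht⟩ := hx
      obtain ⟨t', ht'⟩ := hx'
      refine ⟨t + t', fun y z h => ?_⟩
      obtain ⟨w, hw⟩ := hpq.leftAct x y
      obtain ⟨w', hw'⟩ := hpq.leftAct x' y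
      have : z = w + w' := hpq.ext' fun s => by rw [h s, (hw.add_left hw') s]
      rw [this, map_add, ht _ _ hw, ht' _ _ hw', map_add, LinearMap.add_apply]
    | tmul x x' =>
      obtain ⟨t, ht⟩ := hl x x'
      refine ⟨t, fun y => ?_⟩
      induction y with
      | zero =>
        intro z h
        have : z = 0 := hpq.sep _ fun x => by rw [h x]; simp
        simp [this]
      | add y y' hy hy' =>
        intro z h
        obtain ⟨w, hw⟩ := hpq.leftAct (x ⊗ₜ x') y
        obtain ⟨w', hw'⟩ := hpq.leftAct (x ⊗ₜ x') y'
        have : z = w + w' := hpq.ext' fun s => by rw [h s, (hw.add_right hw') s]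
        rw [this, map_add, hy _ hw, hy' _ hw', map_add]
      | tmul y y' =>
        intro z h
        obtain ⟨w, hw⟩ := hp.leftAct x y
        obtain ⟨w', hw'⟩ := hq.leftAct x' y'
        have : z = w ⊗ₜ w' := hpq.ext' fun s => by rw [h s, (hw.tmul hw') s]
        rw [this, ht _ _ _ _ hw hw']
  · intro x
    induction x with
    | zero => exact ⟨0, fun y z h => by
        have : z = 0 := hpq.sep _ fun x => by rw [h x]; simp
        simp [this]⟩
    | add x x' hx hx' =>
      obtain ⟨t, ht⟩ := hx
      obtain ⟨t', ht'⟩ := hx'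
      refine ⟨t + t', fun y z h => ?_⟩
      obtain ⟨w, hw⟩ := hpq.rightAct x y
      obtain ⟨w', hw'⟩ := hpq.rightAct x' y
      have : z = w + w' := hpq.ext' fun s => by rw [h s, (hw.add_left hw') s]
      rw [this, map_add, ht _ _ hw, ht' _ _ hw', map_add, LinearMap.add_apply]
    | tmul x x' =>
      obtain ⟨t, ht⟩ := hr x x'
      refine ⟨t, fun y => ?_⟩
      induction y with
      | zero =>
        intro z h
        have : z = 0 := hpq.sep _ fun x => by rw [h x]; simp
        simp [this]
      | add y y' hy hy' =>
        intro z h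
        obtain ⟨w, hw⟩ := hpq.rightAct (x ⊗ₜ x') y
        obtain ⟨w', hw'⟩ := hpq.rightAct (x ⊗ₜ x') y'
        have : z = w + w' := hpq.ext' fun s => by rw [h s, (hw.add_right hw') s]
        rw [this, map_add, hy _ hw, hy' _ hw', map_add]
      | tmul y y' =>
        intro z h
        obtain ⟨w, hw⟩ := hp.rightAct x y
        obtain ⟨w', hw'⟩ := hq.rightAct x' y'
        have : z = w ⊗ₜ w' := hpq.ext' fun s => by rw [h s, (hw.tmul hw') s]
        rw [this, ht _ _ _ _ hw hw']

end Pairings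

namespace AlgebraicQuantumGroup

variable {A : Type*} [NonUnitalRing A] [Module ℂ A] [IsScalarTower ℂ A A] [SMulCommClass ℂ A A]
  (G : AlgebraicQuantumGroup A)

/-! ### The pairings of an algebraic quantum group with its dual -/

theorem isLeftAct_lact (b : G.Dual) (x : A) : IsLeftAct G.ev b x (G.lact b x) :=
  fun b' => G.ev_lact b b' x

theorem isRightAct_ract (b : G.Dual) (x : A) : IsRightAct G.ev b x (G.ract b x) :=
  fun b' => G.ev_ract b b' x

theorem isModulePairing_ev : IsModulePairing G.ev where
  inj b h := G.ev_ext fun x => by rw [h]; simp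
  sep x h := G.eq_of_ev fun b => by rw [h]; simp
  leftAct b x := ⟨_, G.isLeftAct_lact b x⟩
  rightAct b x := ⟨_, G.isRightAct_ract b x⟩

/-- The left action needs elements of `B` in the form φ( · c) and the right action the form φ(e · ).
-/
theorem isModulePairing_ev_flip : IsModulePairing G.ev.flip where
  inj x h := G.eq_of_ev fun b => (h b).trans (map_zero (G.ev b)).symm
  sep b h := G.ev_ext fun x => (h x).trans (by simp)
  leftAct a b := by
    obtain ⟨c, rfl⟩ := G.F.surjective b
    exact ⟨G.F (a * c), fun x => by simp [mul_assoc]⟩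
  rightAct a b := by
    obtain ⟨e, rfl⟩ := G.Φ_surjective b
    exact ⟨G.Φ (e * a), fun x => by simp [mul_assoc]⟩

variable {G} in
theorem eq_lact {b : G.Dual} {x z : A} (h : IsLeftAct G.ev b x z) : z = G.lact b x :=
  G.eq_of_ev fun b' => (h b').trans (G.ev_lact b b' x).symm

variable {G} in
theorem eq_ract {b : G.Dual} {x z : A} (h : IsRightAct G.ev b x z) : z = G.ract b x :=
  G.eq_of_ev fun b' => (h b').trans (G.ev_ract b b' x).symm

/-! ### The coproduct of the dual -/

/-- The map `b ⊗ b' ↦ Δ(b)(1 ⊗ b')` of `B ⊗ B`. -/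
def dualT₁ : (G.Dual ⊗[ℂ] G.Dual) ≃ₗ[ℂ] (G.Dual ⊗[ℂ] G.Dual) :=
  (TensorProduct.congr G.F G.F).symm ≪≫ₗ G.T₃.symm ≪≫ₗ TensorProduct.congr G.F G.F ≪≫ₗ
    TensorProduct.comm ℂ G.Dual G.Dual

theorem dualT₁_F (c c' : A) : G.dualT₁ (G.F c ⊗ₜ G.F c') = TensorProduct.comm ℂ G.Dual G.Dual
    (TensorProduct.congr G.F G.F (G.T₃.symm (c ⊗ₜ c'))) := by
  simp [dualT₁]

/-- The element `(b ⊗ 1)Δ(b')` of `B ⊗ B`, for `b = ψ(d · )` and `b' = φ(e · )`. -/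
def dualT₂ (d e : A) : G.Dual ⊗[ℂ] G.Dual :=
  TensorProduct.map G.Ψ G.Φ (TensorProduct.comm ℂ A A (G.T₄.symm (d ⊗ₜ e)))

/-- By `lact_F_mul`, T₃⁻¹(c ⊗ c') computes (b' ▷ y)c. This identifies `dualT₁` as Δ(b)(1 ⊗ b'). -/
theorem pairing_dualT₁ (b b' : G.Dual) (x y : A) :
    tensorPairing G.ev G.ev (G.dualT₁ (b ⊗ₜ b')) (x ⊗ₜ y) = G.ev b (x * G.lact b' y) := by
  obtain ⟨c, rfl⟩ := G.F.surjective b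
  obtain ⟨c', rfl⟩ := G.F.surjective b'
  rw [ev_F, mul_assoc, lact_F_mul, dualT₁_F]
  generalize G.T₃.symm (c ⊗ₜ c') = s
  induction s with
  | zero => simp
  | add s t hs ht => simp only [map_add, LinearMap.add_apply, mul_add, hs, ht]
  | tmul p q => simp [mul_smul_comm, mul_comm]

theorem pairing_dualT₂ (d e x y : A) :
    tensorPairing G.ev G.ev (G.dualT₂ d e) (x ⊗ₜ y) = G.ev (G.Φ e) (G.ract (G.Ψ d) x * y) := by
  rw [ev_Φ, ← mul_assoc, mul_ract_Ψ, dualT₂]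
  generalize G.T₄.symm (d ⊗ₜ e) = s
  induction s with
  | zero => simp
  | add s t hs ht => simp only [map_add, LinearMap.add_apply, add_mul, hs, ht]
  | tmul p q => simp [smul_mul_assoc]

theorem exists_dual_coproduct (β : G.Dual) : ∃ n : Multiplier (G.Dual ⊗[ℂ] G.Dual),
    IsExtendedPairing (tensorPairing G.ev G.ev) n (G.ev β ∘ₗ LinearMap.mul' ℂ A) := by
  have hev := G.isModulePairing_ev
  apply hev.exists_multiplier_tensor hev
  · intro b b'
    refine ⟨(LinearMap.mulRight ℂ b).rTensor _ (G.dualT₁ (β ⊗ₜ b')), fun y y' z z' hz hz' => ?_⟩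
    have h : ∀ t : G.Dual ⊗[ℂ] G.Dual, tensorPairing G.ev G.ev
        ((LinearMap.mulRight ℂ b).rTensor _ t) (y ⊗ₜ y') =
          tensorPairing G.ev G.ev t (G.lact b y ⊗ₜ y') := by
      intro t
      induction t with
      | zero => simp
      | add s t hs ht => simp only [map_add, LinearMap.add_apply, hs, ht]
      | tmul u v => simp [ev_lact]
    rw [h, pairing_dualT₁, eq_lact hz, eq_lact hz']
    simp
  · intro b b'
    obtain ⟨d, rfl⟩ := G.Ψ_surjective b
    obtain ⟨e, rfl⟩ := G.Φ_surjective β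
    refine ⟨(LinearMap.mulLeft ℂ b').lTensor _ (G.dualT₂ d e), fun y y' z z' hz hz' => ?_⟩
    have h : ∀ t : G.Dual ⊗[ℂ] G.Dual, tensorPairing G.ev G.ev
        ((LinearMap.mulLeft ℂ b').lTensor _ t) (y ⊗ₜ y') =
          tensorPairing G.ev G.ev t (y ⊗ₜ G.ract b' y') := by
      intro t
      induction t with
      | zero => simp
      | add s t hs ht => simp only [map_add, LinearMap.add_apply, hs, ht]
      | tmul u v => simp [ev_ract]
    rw [h, pairing_dualT₂, eq_ract hz, eq_ract hz']
    simp

/-- The coproduct of the dual. -/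
def dualΔ : G.Dual →ₗ[ℂ] Multiplier (G.Dual ⊗[ℂ] G.Dual) where
  toFun b := (G.exists_dual_coproduct b).choose
  map_add' b b' := by
    have h := (G.exists_dual_coproduct b).choose_spec
    have h' := (G.exists_dual_coproduct b').choose_spec
    refine (G.isModulePairing_ev.tensor G.isModulePairing_ev).multiplier_eq
      (G.exists_dual_coproduct (b + b')).choose_spec ⟨fun x y z hz => ?_, fun x y z hz => ?_⟩
    · rw [map_add, LinearMap.add_comp, LinearMap.add_apply, h.1 x y z hz, h'.1 x y z hz,
        ← LinearMap.add_apply, ← map_add]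
      rfl
    · rw [map_add, LinearMap.add_comp, LinearMap.add_apply, h.2 x y z hz, h'.2 x y z hz,
        ← LinearMap.add_apply, ← map_add]
      rfl
  map_smul' r b := by
    have h := (G.exists_dual_coproduct b).choose_spec
    refine (G.isModulePairing_ev.tensor G.isModulePairing_ev).multiplier_eq
      (G.exists_dual_coproduct (r • b)).choose_spec ⟨fun x y z hz => ?_, fun x y z hz => ?_⟩
    · rw [map_smul, LinearMap.smul_comp, LinearMap.smul_apply, h.1 x y z hz,
        ← LinearMap.smul_apply, ← map_smul]
      rfl
    · rw [map_smul, LinearMap.smul_comp, LinearMap.smul_apply, h.2 x y z hz,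
        ← LinearMap.smul_apply, ← map_smul]
      rfl

theorem isDualCoproduct : G.IsDualCoproduct G.dualΔ :=
  fun b => (G.exists_dual_coproduct b).choose_spec

theorem isThe_dualΔ : IsThe G.IsDualCoproduct G.dualΔ :=
  ⟨G.isDualCoproduct, fun _ h => LinearMap.ext fun b =>
    (G.isModulePairing_ev.tensor G.isModulePairing_ev).multiplier_eq (h b) (G.isDualCoproduct b)⟩

theorem nondegenerate_dual_tensor : Nondegenerate (G.Dual ⊗[ℂ] G.Dual) :=
  G.nondegenerate_dual.tensor G.nondegenerate_dual

theorem dualT₁_spec (b b' : G.Dual) : Multiplier.of (G.dualT₁ (b ⊗ₜ b')) =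
    G.dualΔ b * Multiplier.tmul 1 (Multiplier.of b') := by
  apply G.nondegenerate_dual_tensor.ext_left
  intro u
  induction u with
  | zero => simp
  | add u v hu hv => simp only [map_add, hu, hv]
  | tmul u v =>
    apply ext_tensorPairing G.isModulePairing_ev G.isModulePairing_ev
    intro x y
    simp only [Multiplier.of_left, Multiplier.mul_left, Multiplier.tmul_left, Multiplier.one_left]
    rw [← (G.isLeftAct_lact u x).tmul (G.isLeftAct_lact v y), pairing_dualT₁, ← lact_mul,
      ← (G.isDualCoproduct b).1 _ _ _ ((G.isLeftAct_lact u x).tmul (G.isLeftAct_lact (b' * v) y))]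
    simp

theorem dualT₂_spec (d e : A) : Multiplier.of (G.dualT₂ d e) =
    Multiplier.tmul (Multiplier.of (G.Ψ d)) 1 * G.dualΔ (G.Φ e) := by
  apply G.nondegenerate_dual_tensor.ext_right
  intro u
  induction u with
  | zero => simp
  | add u v hu hv => simp only [map_add, hu, hv]
  | tmul u v =>
    apply ext_tensorPairing G.isModulePairing_ev G.isModulePairing_ev
    intro x y
    simp only [Multiplier.of_right, Multiplier.mul_right, Multiplier.tmul_right,
      Multiplier.one_right]
    rw [← (G.isRightAct_ract u x).tmul (G.isRightAct_ract v y), pairing_dualT₂, ← ract_mul,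
      ← (G.isDualCoproduct (G.Φ e)).2 _ _ _
        ((G.isRightAct_ract (u * G.Ψ d) x).tmul (G.isRightAct_ract v y))]
    simp

/-! ### The counit and the antipode of the dual -/

/-- The counit of the dual, `φ( · c) ↦ φ(c)`. -/
def dualε : Module.Dual ℂ G.Dual := G.φ ∘ₗ G.F.symm.toLinearMap

@[simp] theorem dualε_F (c : A) : G.dualε (G.F c) = G.φ c := by simp [dualε]

/-- A is spanned by products: y ↦ m(T₁⁻¹(u ⊗ y)) is the identity when ε(u) = 1, and ε = 0 would make
all products zero. -/
theorem mul_induction (G : AlgebraicQuantumGroup A) (x : A) (P : A → Prop) (h0 : P 0)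
    (hadd : ∀ x y, P x → P y → P (x + y)) (h : ∀ x y, P (x * y)) : P x := by
  have hm : ∀ t, P (G.canonicalMaps.m t) := by
    intro t
    induction t with
    | zero => simpa using h0
    | add s t hs ht => rw [map_add]; exact hadd _ _ hs ht
    | tmul x y => rw [CanonicalMaps.m_tmul]; exact h x y
  by_cases hε : G.ε = 0
  · have : x = 0 := G.eq_zero_of_mul_left x fun y => by
      have := G.antipode.counit.T₁ (x ⊗ₜ y)
      rw [hε, CanonicalMaps.m_tmul] at this
      exact this.symm.trans (by simp [sliceLeft])
    rwa [this]
  · obtain ⟨u, hu⟩ := exists_apply_eq_one hε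
    have := hm (G.T₁.symm (u ⊗ₜ x))
    rw [← G.antipode.counit.T₁] at this
    change P (sliceLeft G.ε (G.T₁ _)) at this
    simpa [hu] using this

-- Write φ(ex) = φ(xσ(e)). The claim is φ ∘ σ = φ; since σ is multiplicative, φ(σ(x)σ(y)) = φ(yσ(x))
-- = φ(xy), and products span A.
@[simp] theorem dualε_Φ (e : A) : G.dualε (G.Φ e) = G.φ e := by
  have hσ : ∀ e x, G.φ (e * x) = G.φ (x * G.F.symm (G.Φ e)) := fun e x => by
    rw [← G.ev_F (G.F.symm _), LinearEquiv.apply_symm_apply, ev_Φ]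
  induction e using G.mul_induction with
  | h0 => simp
  | hadd x y hx hy => simp only [map_add, hx, hy]
  | h x y =>
    have h : G.F.symm (G.Φ (x * y)) = G.F.symm (G.Φ x) * G.F.symm (G.Φ y) := by
      apply G.F.injective
      apply G.ev_ext
      intro z
      rw [LinearEquiv.apply_symm_apply, ev_Φ, ev_F, mul_assoc, hσ x, mul_assoc, hσ y, mul_assoc]
    change G.φ (G.F.symm (G.Φ (x * y))) = _
    rw [h, ← hσ, ← hσ]

/-- The antipode of the dual, `b ↦ b ∘ S`. -/
def dualS : G.Dual →ₗ[ℂ] G.Dual := G.Ψ ∘ₗ G.Sinv ∘ₗ G.F.symm.toLinearMap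

@[simp] theorem ev_dualS (b : G.Dual) (x : A) : G.ev (G.dualS b) x = G.ev b (G.S x) := by
  obtain ⟨c, rfl⟩ := G.F.surjective b
  simp [dualS, ψ_apply, S_mul]

theorem dualS_surjective : Function.Surjective G.dualS :=
  G.Ψ_surjective.comp (G.Sinv_bijective.2.comp G.F.symm.surjective)

theorem sliceLeft_dualT₁ (b b' : G.Dual) : sliceLeft G.dualε (G.dualT₁ (b ⊗ₜ b')) = b * b' := by
  obtain ⟨c, rfl⟩ := G.F.surjective b
  obtain ⟨c', rfl⟩ := G.F.surjective b'
  apply G.ev_ext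
  intro x
  rw [← ev_lact, ev_F, lact_F_mul, ← apply_sliceRight, dualT₁_F]
  generalize G.T₃.symm (c ⊗ₜ c') = s
  induction s with
  | zero => simp
  | add s t hs ht => simp only [map_add, LinearMap.add_apply, hs, ht]
  | tmul p q => simp

theorem sliceRight_dualT₂ (d e : A) :
    sliceRight G.dualε (G.dualT₂ d e) = G.Ψ d * G.Φ e := by
  apply G.ev_ext
  intro x
  rw [← ev_ract, ev_Φ, mul_ract_Ψ, apply_sliceRight, dualT₂]
  generalize G.T₄.symm (d ⊗ₜ e) = s
  induction s with
  | zero => simp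
  | add s t hs ht => simp only [map_add, LinearMap.add_apply, hs, ht]
  | tmul p q => simp

/-- By `S_lact_F_mul` the antipode reintroduces T₃, which cancels the T₃⁻¹ of the coproduct; what
remains at x is φ(c)φ(xc'). -/
theorem mul_dualS_dualT₁ (b b' : G.Dual) :
    LinearMap.mul' ℂ G.Dual (G.dualS.rTensor G.Dual (G.dualT₁ (b ⊗ₜ b'))) = G.dualε b • b' := by
  obtain ⟨c, rfl⟩ := G.F.surjective b
  obtain ⟨c', rfl⟩ := G.F.surjective b'
  apply G.ev_ext
  intro x
  have h : ∀ s, G.ev (LinearMap.mul' ℂ G.Dual (G.dualS.rTensor G.Dual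
      (TensorProduct.comm ℂ G.Dual G.Dual (TensorProduct.congr G.F G.F s)))) x =
      G.φ (sliceRight (G.φ ∘ₗ LinearMap.mul ℂ A x) (G.T₃ s)) := by
    intro s
    induction s with
    | zero => simp
    | add s t hs ht => simp only [map_add, LinearMap.add_apply, hs, ht]
    | tmul p q =>
      rw [← S_lact_F_mul]
      simp [← ev_lact]
  rw [dualT₁_F, h, LinearEquiv.apply_symm_apply]
  simp [mul_comm]

theorem mul_dualS_dualT₂ (d e : A) :
    LinearMap.mul' ℂ G.Dual (G.dualS.lTensor G.Dual (G.dualT₂ d e)) =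
      G.dualε (G.Φ e) • G.Ψ d := by
  apply G.ev_ext
  intro x
  have h : ∀ s, G.ev (LinearMap.mul' ℂ G.Dual (G.dualS.lTensor G.Dual
      (TensorProduct.map G.Ψ G.Φ (TensorProduct.comm ℂ A A s)))) x =
      G.φ (sliceLeft (G.ψ ∘ₗ (LinearMap.mul ℂ A).flip x) (G.T₄ s)) := by
    intro s
    induction s with
    | zero => simp
    | add s t hs ht => simp only [map_add, LinearMap.add_apply, hs, ht]
    | tmul p q =>
      rw [← mul_S_ract_Ψ]
      simp [← ev_ract]
  rw [dualT₂, h, LinearEquiv.apply_symm_apply]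
  simp [mul_comm]

theorem isAntipode_dualS : IsAntipode G.dualΔ G.dualS := by
  refine ⟨G.dualε, ⟨fun b b' => ⟨_, G.dualT₁_spec b b', G.sliceLeft_dualT₁ b b'⟩,
    fun b b' => ?_⟩, fun b b' => ⟨_, G.dualT₁_spec b b', G.mul_dualS_dualT₁ b b'⟩,
    fun b b' => ?_⟩ <;>
  obtain ⟨d, rfl⟩ := G.Ψ_surjective b <;>
  obtain ⟨e, rfl⟩ := G.Φ_surjective b'
  · exact ⟨_, G.dualT₂_spec d e, G.sliceRight_dualT₂ d e⟩
  · exact ⟨_, G.dualT₂_spec d e, G.mul_dualS_dualT₂ d e⟩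

theorem isThe_dualS : IsThe (IsAntipode G.dualΔ) G.dualS :=
  ⟨G.isAntipode_dualS, fun _ h => IsAntipode.eq G.nondegenerate_dual
    (T := G.dualT₁.toLinearMap) G.dualT₁_spec G.dualT₁.surjective h G.isAntipode_dualS⟩

/-- Strong invariance in terms of the action: S exchanges the roles of c and x. -/
theorem S_lact_F (c x : A) : G.S (G.lact (G.F c) x) = G.lact (G.Φ x) c := by
  rw [lact_F, S_slice_T₁, lact_Φ]

theorem dualS_mul_F (b : G.Dual) (c : A) : G.dualS b * G.F c = G.F (G.ract b c) := by
  apply G.ev_ext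
  intro x
  rw [← ev_lact, ev_dualS, S_lact_F, ev_lact, ← ev_ract, ev_Φ, ev_F]

/-- As A = B ▷ A, take x = φ( · c) ▷ y. Then S(x) = φ(y · ) ▷ c, the two actions commute, and c ◁ b
corresponds to left multiplication of φ( · c) by S(b). -/
theorem ract_S (b : G.Dual) (x : A) : G.ract b (G.S x) = G.S (G.lact (G.dualS b) x) := by
  induction x using G.lact_induction with
  | h0 => simp
  | hadd x y hx hy => simp only [map_add, hx, hy]
  | h b' y =>
    obtain ⟨c, rfl⟩ := G.F.surjective b'
    rw [S_lact_F, ← lact_ract, ← S_lact_F, ← dualS_mul_F, lact_mul]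

theorem dualS_mul (b b' : G.Dual) : G.dualS (b * b') = G.dualS b' * G.dualS b := by
  apply G.ev_ext
  intro x
  rw [ev_dualS, ← ev_ract, ract_S, ← ev_dualS, ev_lact]

theorem lact_S (b : G.Dual) (x : A) : G.lact b (G.S x) = G.S (G.ract (G.dualS b) x) := by
  apply G.eq_of_ev
  intro b'
  rw [ev_lact, ← ev_dualS, dualS_mul, ← ev_ract, ev_dualS]

/-! ### The duality -/

theorem ext_slice_ev {t t' : G.Dual ⊗[ℂ] A}
    (h : ∀ x, sliceLeft (G.ev.flip x) t = sliceLeft (G.ev.flip x) t') : t = t' :=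
  ext_tensorPairing G.isModulePairing_ev G.isModulePairing_ev_flip fun x w => by
    rw [tensorPairing_apply, h, tensorPairing_apply]

/-- The map `b ⊗ a ↦ V(b ⊗ a)` of `B ⊗ A`. -/
def Vleft : (G.Dual ⊗[ℂ] A) ≃ₗ[ℂ] (G.Dual ⊗[ℂ] A) :=
  (TensorProduct.congr G.F (LinearEquiv.refl ℂ A)).symm ≪≫ₗ TensorProduct.comm ℂ A A ≪≫ₗ
    G.T₃.symm ≪≫ₗ TensorProduct.congr G.F (LinearEquiv.refl ℂ A)

/-- `Ψ d = ψ(d · )`, as a linear equivalence. -/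
def Ψequiv : A ≃ₗ[ℂ] G.Dual := LinearEquiv.ofBijective G.Ψ
  ⟨(injective_iff_map_eq_zero G.Ψ).2 fun d hd => by
    apply G.S_bijective.1
    rw [map_zero]
    apply G.eq_zero_of_φ_mul_right
    intro x
    rw [← G.S_Sinv x, ← S_mul, ← ψ_apply, ← ev_Ψ, hd]
    simp, G.Ψ_surjective⟩

/-- The map `b ⊗ a ↦ (b ⊗ a)V` of `B ⊗ A`. -/
def Vright : (G.Dual ⊗[ℂ] A) ≃ₗ[ℂ] (G.Dual ⊗[ℂ] A) :=
  (TensorProduct.congr G.Ψequiv (LinearEquiv.refl ℂ A)).symm ≪≫ₗ G.T₄.symm ≪≫ₗ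
    TensorProduct.comm ℂ A A ≪≫ₗ TensorProduct.congr G.Ψequiv (LinearEquiv.refl ℂ A)

theorem slice_ev_congr_F (x : A) (s : A ⊗[ℂ] A) :
    sliceLeft (G.ev.flip x) (TensorProduct.congr G.F (LinearEquiv.refl ℂ A) s) =
      sliceLeft (G.φ ∘ₗ LinearMap.mul ℂ A x) s :=
  sliceLeft_map _ G.F.toLinearMap LinearMap.id s

theorem slice_ev_congr_Ψ (x : A) (s : A ⊗[ℂ] A) :
    sliceLeft (G.ev.flip x) (TensorProduct.congr G.Ψequiv (LinearEquiv.refl ℂ A) s) =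
      sliceLeft (G.ψ ∘ₗ (LinearMap.mul ℂ A).flip x) s :=
  sliceLeft_map _ G.Ψequiv.toLinearMap LinearMap.id s

theorem slice_Vleft (b : G.Dual) (a x : A) :
    sliceLeft (G.ev.flip x) (G.Vleft (b ⊗ₜ a)) = G.lact b x * a := by
  obtain ⟨c, rfl⟩ := G.F.surjective b
  rw [lact_F_mul, ← slice_ev_congr_F]
  simp [Vleft]

theorem slice_Vright (b : G.Dual) (a x : A) :
    sliceLeft (G.ev.flip x) (G.Vright (b ⊗ₜ a)) = a * G.ract b x := by
  obtain ⟨d, rfl⟩ := G.Ψequiv.surjective b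
  refine Eq.trans ?_ (G.mul_ract_Ψ d x a).symm
  rw [← sliceLeft_comm, ← slice_ev_congr_Ψ]
  simp [Vright]

/-- Inverting T₃⁻¹ gives T₃, whose slices are values of S by `S_lact_F_mul`; this is how the
antipode appears in the inverse of V. -/
theorem slice_Vleft_symm (b : G.Dual) (a x : A) :
    sliceLeft (G.ev.flip x) (G.Vleft.symm (b ⊗ₜ a)) = G.S (G.lact b x) * a := by
  obtain ⟨c, rfl⟩ := G.F.surjective b
  rw [S_lact_F_mul, ← sliceLeft_comm, ← slice_ev_congr_F]
  simp [Vleft]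

theorem slice_Vright_symm (b : G.Dual) (a x : A) :
    sliceLeft (G.ev.flip x) (G.Vright.symm (b ⊗ₜ a)) = a * G.S (G.ract b x) := by
  obtain ⟨d, rfl⟩ := G.Ψequiv.surjective b
  refine Eq.trans ?_ (G.mul_S_ract_Ψ d x a).symm
  rw [← slice_ev_congr_Ψ]
  simp [Vright]

theorem exists_duality : ∃ V, G.IsDuality V := by
  apply G.isModulePairing_ev.exists_multiplier_tensor G.isModulePairing_ev_flip
  · intro b a
    refine ⟨G.Vleft (b ⊗ₜ a), fun x w z z' hz hz' => ?_⟩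
    rw [tensorPairing_apply, slice_Vleft, eq_lact hz]
    exact hz' _
  · intro b a
    refine ⟨G.Vright (b ⊗ₜ a), fun x w z z' hz hz' => ?_⟩
    rw [tensorPairing_apply, slice_Vright, eq_ract hz]
    exact hz' _

/-- The duality. -/
def V : Multiplier (G.Dual ⊗[ℂ] A) := G.exists_duality.choose

theorem isDuality_V : G.IsDuality G.V := G.exists_duality.choose_spec

theorem isThe_V : IsThe G.IsDuality G.V :=
  ⟨G.isDuality_V, fun _ h => (G.isModulePairing_ev.tensor G.isModulePairing_ev_flip).multiplier_eq
    h G.isDuality_V⟩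

theorem V_left (t : G.Dual ⊗[ℂ] A) : G.V.left t = G.Vleft t := by
  induction t with
  | zero => simp
  | add s t hs ht => simp only [map_add, hs, ht]
  | tmul b a =>
    apply ext_tensorPairing G.isModulePairing_ev G.isModulePairing_ev_flip
    intro x w
    obtain ⟨w', hw'⟩ := G.isModulePairing_ev_flip.leftAct a w
    rw [← G.isDuality_V.1 _ _ _ ((G.isLeftAct_lact b x).tmul hw'), tensorPairing_apply, slice_Vleft]
    exact hw' _

theorem V_right (t : G.Dual ⊗[ℂ] A) : G.V.right t = G.Vright t := by
  induction t with
  | zero => simp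
  | add s t hs ht => simp only [map_add, hs, ht]
  | tmul b a =>
    apply ext_tensorPairing G.isModulePairing_ev G.isModulePairing_ev_flip
    intro x w
    obtain ⟨w', hw'⟩ := G.isModulePairing_ev_flip.rightAct a w
    rw [← G.isDuality_V.2 _ _ _ ((G.isRightAct_ract b x).tmul hw'), tensorPairing_apply,
      slice_Vright]
    exact hw' _

/-- The inverse of the duality. -/
def W : Multiplier (G.Dual ⊗[ℂ] A) :=
  ⟨(G.Vleft.symm.toLinearMap, MulOpposite.op G.Vright.symm.toLinearMap), fun x y => by
    -- Writing x and y as images under V turns the compatibility condition for W into the one for V.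
    obtain ⟨x, rfl⟩ := G.Vright.surjective x
    obtain ⟨y, rfl⟩ := G.Vleft.surjective y
    have h := G.V.mul_left_eq x y
    rw [V_left, V_right] at h
    simpa using h.symm⟩

theorem W_left (t : G.Dual ⊗[ℂ] A) : G.W.left t = G.Vleft.symm t := rfl

theorem W_right (t : G.Dual ⊗[ℂ] A) : G.W.right t = G.Vright.symm t := rfl

theorem V_mul_W : G.V * G.W = 1 :=
  Multiplier.ext (fun t => by simp [V_left, W_left]) (fun t => by simp [V_right, W_right])

theorem W_mul_V : G.W * G.V = 1 :=
  Multiplier.ext (fun t => by simp [V_left, W_left]) (fun t => by simp [V_right, W_right])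

theorem nondegenerate_dual_tensor_self : Nondegenerate (G.Dual ⊗[ℂ] A) :=
  G.nondegenerate_dual.tensor G.nondegenerate

theorem slice_ev_mul_tmul (t : G.Dual ⊗[ℂ] A) (u : G.Dual) (v x : A) :
    sliceLeft (G.ev.flip x) (t * (u ⊗ₜ v)) = sliceLeft (G.ev.flip (G.lact u x)) t * v := by
  induction t with
  | zero => simp
  | add s t hs ht => simp only [map_add, add_mul, hs, ht]
  | tmul b a => simp [ev_lact, smul_mul_assoc]

/-- The element `(b ⊗ 1)V(1 ⊗ a)` of `B ⊗ A`. -/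
def Vmid (b : G.Dual) (a : A) : G.Dual ⊗[ℂ] A :=
  G.Sinv.lTensor G.Dual (G.W.right (b ⊗ₜ G.S a))

/-- The element `(1 ⊗ a)V(b ⊗ 1)` of `B ⊗ A`. -/
def Vmid' (b : G.Dual) (a : A) : G.Dual ⊗[ℂ] A :=
  G.Sinv.lTensor G.Dual (G.W.left (b ⊗ₜ G.S a))

theorem slice_Vmid (b : G.Dual) (a x : A) :
    sliceLeft (G.ev.flip x) (G.Vmid b a) = G.ract b x * a := by
  rw [Vmid, sliceLeft_lTensor, W_right, slice_Vright_symm, ← S_mul, Sinv_S]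

theorem slice_Vmid' (b : G.Dual) (a x : A) :
    sliceLeft (G.ev.flip x) (G.Vmid' b a) = a * G.lact b x := by
  rw [Vmid', sliceLeft_lTensor, W_left, slice_Vleft_symm, ← S_mul, Sinv_S]

/-- After multiplication by u ⊗ v the slices are ((u ▷ x) ◁ b)av and (u ▷ (x ◁ b))av, equal because
the actions commute. -/
theorem of_Vmid (b : G.Dual) (a : A) : Multiplier.of (G.Vmid b a) =
    Multiplier.tmul (Multiplier.of b) 1 * G.V * Multiplier.tmul 1 (Multiplier.of a) := by
  apply G.nondegenerate_dual_tensor_self.ext_left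
  intro u
  induction u with
  | zero => simp
  | add u v hu hv => simp only [map_add, hu, hv]
  | tmul u v =>
    apply G.ext_slice_ev
    intro x
    have h : G.ev.flip x ∘ₗ (Multiplier.of b).left = G.ev.flip (G.ract b x) :=
      LinearMap.ext fun w => (G.ev_ract b w x).symm
    simp only [Multiplier.of_left, Multiplier.mul_left, Multiplier.tmul_left, Multiplier.one_left]
    rw [slice_ev_mul_tmul, slice_Vmid, tmul_one_left, sliceLeft_rTensor, h, V_left, slice_Vleft,
      lact_ract, mul_assoc]

theorem of_Vmid' (b : G.Dual) (a : A) : Multiplier.of (G.Vmid' b a) =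
    Multiplier.tmul 1 (Multiplier.of a) * G.V * Multiplier.tmul (Multiplier.of b) 1 := by
  apply G.nondegenerate_dual_tensor_self.ext_left
  intro u
  induction u with
  | zero => simp
  | add u v hu hv => simp only [map_add, hu, hv]
  | tmul u v =>
    apply G.ext_slice_ev
    intro x
    simp only [Multiplier.of_left, Multiplier.mul_left, Multiplier.tmul_left, Multiplier.one_left]
    rw [slice_ev_mul_tmul, slice_Vmid', one_tmul_left, sliceLeft_lTensor, V_left, slice_Vleft,
      lact_mul, Multiplier.of_left, mul_assoc]

theorem slice_dualS_rTensor (t : G.Dual ⊗[ℂ] A) (x : A) :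
    sliceLeft (G.ev.flip x) (G.dualS.rTensor A t) = sliceLeft (G.ev.flip (G.S x)) t := by
  rw [sliceLeft_rTensor]
  congr 2
  exact LinearMap.ext fun b => G.ev_dualS b x

/-- The slices at x are S(S(b) ▷ x)a and (S(x) ◁ b)a. -/
theorem W_left_dualS (b : G.Dual) (a : A) :
    G.W.left (G.dualS b ⊗ₜ a) = G.dualS.rTensor A (G.Vmid b a) :=
  G.ext_slice_ev fun x => by
    rw [W_left, slice_Vleft_symm, slice_dualS_rTensor, slice_Vmid, ract_S]

theorem W_right_dualS (b : G.Dual) (a : A) :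
    G.W.right (G.dualS b ⊗ₜ a) = G.dualS.rTensor A (G.Vmid' b a) :=
  G.ext_slice_ev fun x => by
    rw [W_right, slice_Vright_symm, slice_dualS_rTensor, slice_Vmid', lact_S]

theorem S_lTensor_Sinv (t : G.Dual ⊗[ℂ] A) :
    G.S.lTensor G.Dual (G.Sinv.lTensor G.Dual t) = t := by
  induction t with
  | zero => simp
  | add s t hs ht => simp only [map_add, hs, ht]
  | tmul b a => simp

theorem isThe_antiLeft : IsThe (IsAntiLeft G.dualS G.V) G.W := by
  refine ⟨fun b a => ⟨⟨_, G.of_Vmid b a, G.W_left_dualS b a⟩,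
    ⟨_, G.of_Vmid' b a, G.W_right_dualS b a⟩⟩, fun Y hY => ?_⟩
  apply G.nondegenerate_dual_tensor_self.ext_left
  intro u
  induction u with
  | zero => simp
  | add u v hu hv => simp only [map_add, hu, hv]
  | tmul b a =>
    obtain ⟨b, rfl⟩ := G.dualS_surjective b
    obtain ⟨t, ht, ht'⟩ := (hY b a).1
    rw [← of_Vmid] at ht
    rw [ht', G.nondegenerate_dual_tensor_self.of_injective ht, W_left_dualS]

/-- Existence is built into `Vmid` and `Vmid'`, defined from W by undoing S on the second leg.
Uniqueness holds because the elements b ⊗ S(a) span. -/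
theorem isThe_antiRight : IsThe (IsAntiRight G.S G.V) G.W := by
  refine ⟨fun b a => ⟨⟨_, G.of_Vmid' b a, (G.S_lTensor_Sinv _).symm⟩,
    ⟨_, G.of_Vmid b a, (G.S_lTensor_Sinv _).symm⟩⟩, fun Y hY => ?_⟩
  apply G.nondegenerate_dual_tensor_self.ext_left
  intro u
  induction u with
  | zero => simp
  | add u v hu hv => simp only [map_add, hu, hv]
  | tmul b a =>
    obtain ⟨a, rfl⟩ := G.S_bijective.2 a
    obtain ⟨t, ht, ht'⟩ := (hY b a).1
    rw [← of_Vmid'] at ht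
    rw [ht', G.nondegenerate_dual_tensor_self.of_injective ht]
    exact G.S_lTensor_Sinv _

end AlgebraicQuantumGroup

end AQG

end

open TensorProduct AQG in
theorem mainTheorem2 {A : Type*} [NonUnitalRing A] [Module ℂ A] [IsScalarTower ℂ A A]
    [SMulCommClass ℂ A A] (G : AlgebraicQuantumGroup A) :
    ∃ (Δ' : G.Dual →ₗ[ℂ] Multiplier (G.Dual ⊗[ℂ] G.Dual))
      (S : A →ₗ[ℂ] A) (S' : G.Dual →ₗ[ℂ] G.Dual)
      (V W W' : Multiplier (G.Dual ⊗[ℂ] A)),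
      IsThe G.IsDualCoproduct Δ' ∧
      IsThe (IsAntipode (G.Δ : A →ₗ[ℂ] Multiplier (A ⊗[ℂ] A))) S ∧
      IsThe (IsAntipode Δ') S' ∧
      IsThe G.IsDuality V ∧
      IsThe (IsAntiLeft S' V) W ∧
      IsThe (IsAntiRight S V) W' ∧
      V * W = 1 ∧ W * V = 1 ∧ W = W' :=
  ⟨G.dualΔ, G.S, G.dualS, G.V, G.W, G.W, G.isThe_dualΔ, G.isThe_antipode, G.isThe_dualS, G.isThe_V,
    G.isThe_antiLeft, G.isThe_antiRight, G.V_mul_W, G.W_mul_V, rfl⟩
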